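/- All $C^*$-algebras are unital and homomorphisms between them are unital $*$-homomorphisms. Let $\Sigma=(A,G,\alpha,\sigma)$ and $\Theta=(B,G,\beta,\theta)$ be twisted unital discrete $C^*$-dynamical systems over the same discrete group $G$; that is, $\alpha:G\to\mathrm{Aut}(A)$ and $\sigma:G\times G\to\mathcal U(A)$ satisfy $\alpha_g\alpha_h=\mathrm{Ad}(\sigma(g,h))\,\alpha_{gh}$, $\sigma(g,h)\sigma(gh,k)=\alpha_g(\sigma(h,k))\sigma(g,hk)$ and $\sigma(g,e)=\sigma(e,g)=1_A$, and similarly for $\Theta$. An equivariant representation of $\Sigma$ on a right Hilbert $A$-module $X$ is a pair $(\rho,v)$, where $\rho:A\to\mathcal L_A(X)$ is a homomorphism and $v$ maps $G$ into the invertible bounded linear maps of $X$, such that $\rho(\alpha_g(a))=v(g)\rho(a)v(g)^{-1}$, $v(g)v(h)x=\big(\rho(\sigma(g,h))\,v(gh)x\big)\cdot\sigma(g,h)^*$, $\alpha_g(\langle x,x'\rangle)=\langle v(g)x,v(g)x'\rangle$ and $v(g)(x\cdot a)=(v(g)x)\cdot\alpha_g(a)$. The Fourier--Stieltjes algebra $B(\Sigma)$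 is the set of all maps $T_{\rho,v,x,y}:G\times A\to A$, $T_{\rho,v,x,y}(g,a)=\langle x,\rho(a)v(g)y\rangle$, where $(\rho,v)$ is an equivariant representation of $\Sigma$ on some right Hilbert $A$-module $X$ and $x,y\in X$; $B(\Theta)$ is defined in the same way. Suppose that $\Sigma$ and $\Theta$ are Morita equivalent via $(Z,\delta)$: $Z$ is an $A$-$B$ imprimitivity bimodule (a full right and full left Hilbert $A$-$B$-bimodule with ${}_A\langle z,z'\rangle\cdot z''=z\cdot\langle z',z''\rangle_B$), and $\delta$ maps $G$ into the invertible bounded linear maps of $Z$ with $\delta(g)(a\cdot z)=\alpha_g(a)\cdot\delta(g)z$, $\delta(g)(z\cdot b)=(\delta(g)z)\cdot\beta_g(b)$, $\delta(g)\delta(h)z=\sigma(g,h)\cdot(\delta(gh)z)\cdot\theta(g,h)^*$ and $\langle\delta(g)z,\delta(g)\zeta\rangle_B=\beta_g(\langle z,\zeta\rangle_B)$. Let $\widetilde Z=\{\tilde z: z\in Z\}$ be the conjugate right Hilbert $B$-$A$-bimodule, with $b\cdot\tilde z=(z\cdot b^*)^{\sim}$, $\tilde z\cdot a=(a^*\cdot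 z)^{\sim}$, $\langle\tilde z,\tilde\zeta\rangle_A={}_A\langle z,\zeta\rangle$, and let $\tilde\delta(g)\tilde z=(\delta(g)z)^{\sim}$. For $z,\zeta\in Z$ define $S_{\delta,z,\zeta}:G\times A\to B$ and $S_{\tilde\delta,\tilde z,\tilde\zeta}:G\times B\to A$ by $$S_{\delta,z,\zeta}(g,a)=\langle z,a\cdot\delta(g)\zeta\rangle_B,\qquad S_{\tilde\delta,\tilde z,\tilde\zeta}(g,b)=\langle\tilde z,b\cdot\tilde\delta(g)\tilde\zeta\rangle_A .$$ Write $(S\cdot T)(g,c)=S(g,T(g,c))$ for composable maps. Then $$B(\Theta)=\mathrm{Span}\big\{S_{\delta,z',\zeta'}\cdot T\cdot S_{\tilde\delta,\tilde z,\tilde\zeta}\ :\ T\in B(\Sigma),\ z,z',\zeta,\zeta'\in Z\big\}$$ and $$B(\Sigma)=\mathrm{Span}\big\{S_{\tilde\delta,\tilde z,\tilde\zeta}\cdot T'\cdot S_{\delta,z',\zeta'}\ :\ T'\in B(\Theta),\ z,z',\zeta,\zeta'\in Z\big\},$$ where $\mathrm{Span}$ denotes the (algebraic) complex linear span. -/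

import Mathlib

open MulOpposite

universe u

/-! ### Twisted unital discrete C*-dynamical systems -/

/-- A twisted unital discrete C*-dynamical system `(A, G, α, σ)`: a map `α` from the discrete
group `G` to the `*`-automorphisms of the unital C*-algebra `A`, and a normalized 2-cocycle `σ`
for `α` with values in the unitary group of `A`. -/
structure TwistedSystem (A G : Type*) [CStarAlgebra A] [Group G] where
  act : G → (A ≃⋆ₐ[ℂ] A)
  cocycle : G → G → unitary A
  act_act : ∀ (g h : G) (a : A),
    act g (act h a) = (cocycle g h : A) * act (g * h) a * star (cocycle g h : A)
  cocycle_mul : ∀ g h k : G,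
    (cocycle g h : A) * (cocycle (g * h) k : A)
      = act g (cocycle h k : A) * (cocycle g (h * k) : A)
  cocycle_one_right : ∀ g : G, cocycle g 1 = 1
  cocycle_one_left : ∀ g : G, cocycle 1 g = 1

/-! ### Right Hilbert modules and representations on them -/

/-- The structure of a right Hilbert `B`-module on `X`, inducing the given norm of `X`.
The right action is `x · b = smulRight (op b) x`, and the inner product is linear in its second
variable; it is definite because `‖x‖ ^ 2 = ‖⟪x, x⟫‖` and `X` is a normed group. -/
structure RightHilbertModule (B X : Type*) [CStarAlgebra B] [PartialOrder B] [StarOrderedRing B]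
    [NormedAddCommGroup X] [NormedSpace ℂ X] where
  smulRight : Bᵐᵒᵖ →ₐ[ℂ] Module.End ℂ X
  inner : X → X →ₗ[ℂ] B
  inner_smulRight : ∀ (x y : X) (b : B), inner x (smulRight (op b) y) = inner x y * b
  star_inner : ∀ x y : X, star (inner x y) = inner y x
  inner_self_nonneg : ∀ x : X, 0 ≤ inner x x
  norm_sq_eq : ∀ x : X, ‖x‖ ^ 2 = ‖inner x x‖
  complete : CompleteSpace X

/-- A unital `*`-homomorphism from `A` to the C*-algebra of adjointable operators on the right
Hilbert `B`-module `X`: each operator `π a` is adjointable with adjoint `π (star a)`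
(adjointable operators are automatically bounded and `B`-linear). -/
structure HilbertRep (A : Type*) {B X : Type*} [CStarAlgebra A] [CStarAlgebra B] [PartialOrder B]
    [StarOrderedRing B] [NormedAddCommGroup X] [NormedSpace ℂ X]
    (E : RightHilbertModule B X) where
  hom : A →ₐ[ℂ] Module.End ℂ X
  adjoint : ∀ (a : A) (x y : X), E.inner (hom a x) y = E.inner x (hom (star a) y)

/-- A right Hilbert `A`-`B` bimodule. -/
structure HilbertBimodule (A B X : Type*) [CStarAlgebra A] [CStarAlgebra B] [PartialOrder B]
    [StarOrderedRing B] [NormedAddCommGroup X] [NormedSpace ℂ X]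
    extends RightHilbertModule B X where
  left : HilbertRep A toRightHilbertModule

/-! ### Equivariant representations and the Fourier–Stieltjes algebra -/

/-- An equivariant representation `(ρ, v)` of the system `S` on the right Hilbert `A`-module `X`.
Here `X ≃L[ℂ] X` is the group of invertible bounded complex-linear maps of `X`. -/
structure EquivariantRep {A G X : Type*} [CStarAlgebra A] [PartialOrder A] [StarOrderedRing A]
    [Group G] [NormedAddCommGroup X] [NormedSpace ℂ X]
    (S : TwistedSystem A G) (E : RightHilbertModule A X) where
  ρ : HilbertRep A E
  v : G → (X ≃L[ℂ] X)
  conj_eq : ∀ (g : G) (a : A) (x : X), ρ.hom (S.act g a) x = v g (ρ.hom a ((v g).symm x))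
  mul_eq : ∀ (g h : G) (x : X), v g (v h x)
    = E.smulRight (op (star (S.cocycle g h : A))) (ρ.hom (S.cocycle g h : A) (v (g * h) x))
  inner_eq : ∀ (g : G) (x y : X), S.act g (E.inner x y) = E.inner (v g x) (v g y)
  smul_eq : ∀ (g : G) (x : X) (a : A),
    v g (E.smulRight (op a) x) = E.smulRight (op (S.act g a)) (v g x)

/-- Maps `G × A → B` which are linear in the second variable. For `B = A` this is the ambient
algebra `L(Σ)`, with its pointwise linear structure. -/
abbrev CoeffMap (G A B : Type*) [CStarAlgebra A] [CStarAlgebra B] : Type _ := G → A →ₗ[ℂ] B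

/-- The product `(S · T)(g, a) = S(g, T(g, a))`. -/
noncomputable def CoeffMap.mul {G A B C : Type*} [CStarAlgebra A] [CStarAlgebra B] [CStarAlgebra C]
    (S : CoeffMap G B C) (T : CoeffMap G A B) : CoeffMap G A C :=
  fun g => S g ∘ₗ T g

/-- The coefficient `T_{ρ,v,x,y}(g, a) = ⟪x, ρ(a) v(g) y⟫`. -/
noncomputable def EquivariantRep.coeff {A G X : Type*} [CStarAlgebra A] [PartialOrder A] [StarOrderedRing A]
    [Group G] [NormedAddCommGroup X] [NormedSpace ℂ X]
    {S : TwistedSystem A G} {E : RightHilbertModule A X} (R : EquivariantRep S E) (x y : X) :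
    CoeffMap G A A :=
  fun g =>
    { toFun := fun a => E.inner x (R.ρ.hom a (R.v g y))
      map_add' := fun a b => by simp
      map_smul' := fun c a => by simp }

/-- The Fourier–Stieltjes algebra `B(Σ)`: all coefficients of equivariant representations. -/
def FourierStieltjes {A G : Type u} [CStarAlgebra A] [PartialOrder A] [StarOrderedRing A]
    [Group G] (S : TwistedSystem A G) : Set (CoeffMap G A A) :=
  {T | ∃ (X : Type u) (_ : NormedAddCommGroup X) (_ : NormedSpace ℂ X)
    (E : RightHilbertModule A X) (R : EquivariantRep S E) (x y : X), T = R.coeff x y}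

/-! ### Compatible actions and Morita equivalence -/

/-- A `(Σ, Θ)`-compatible action of `G` on a right Hilbert `A`-`B` bimodule. -/
structure CompatibleAction {A B G Z : Type*} [CStarAlgebra A] [CStarAlgebra B] [PartialOrder B]
    [StarOrderedRing B] [Group G] [NormedAddCommGroup Z] [NormedSpace ℂ Z]
    (S : TwistedSystem A G) (Θ : TwistedSystem B G) (E : HilbertBimodule A B Z) where
  δ : G → (Z ≃L[ℂ] Z)
  map_left : ∀ (g : G) (a : A) (z : Z), δ g (E.left.hom a z) = E.left.hom (S.act g a) (δ g z)
  map_right : ∀ (g : G) (z : Z) (b : B),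
    δ g (E.smulRight (op b) z) = E.smulRight (op (Θ.act g b)) (δ g z)
  mul_eq : ∀ (g h : G) (z : Z), δ g (δ h z)
    = E.smulRight (op (star (Θ.cocycle g h : B))) (E.left.hom (S.cocycle g h : A) (δ (g * h) z))
  inner_eq : ∀ (g : G) (z w : Z), E.inner (δ g z) (δ g w) = Θ.act g (E.inner z w)

/-- The map `S_{δ,z,ζ}(g, a) = ⟪z, a · (δ(g) ζ)⟫`. -/
noncomputable def CompatibleAction.coeff {A B G Z : Type*} [CStarAlgebra A] [CStarAlgebra B] [PartialOrder B]
    [StarOrderedRing B] [Group G] [NormedAddCommGroup Z] [NormedSpace ℂ Z]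
    {S : TwistedSystem A G} {Θ : TwistedSystem B G} {E : HilbertBimodule A B Z}
    (d : CompatibleAction S Θ E) (z ζ : Z) : CoeffMap G A B :=
  fun g =>
    { toFun := fun a => E.inner z (E.left.hom a (d.δ g ζ))
      map_add' := fun a b => by simp
      map_smul' := fun c a => by simp }

/-- An `A`-`B` imprimitivity bimodule: a full right Hilbert `A`-`B` bimodule which is also a full
left Hilbert `A`-`B` bimodule for an `A`-valued inner product `leftInner` (linear in the first
variable), with `leftInner z z' · z'' = z · ⟪z', z''⟫`. The norm given by `leftInner` is then the
norm of `Z` (`ImprimitivityBimodule.norm_leftInner_self` below), so definiteness and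
completeness for `leftInner` need not be listed. -/
structure ImprimitivityBimodule (A B Z : Type*) [CStarAlgebra A] [PartialOrder A]
    [StarOrderedRing A] [CStarAlgebra B] [PartialOrder B] [StarOrderedRing B]
    [NormedAddCommGroup Z] [NormedSpace ℂ Z] extends HilbertBimodule A B Z where
  full_right : closure (Submodule.span ℂ {b : B | ∃ z w : Z, b = inner z w} : Set B) = Set.univ
  leftInner : Z → Z → A
  leftInner_add : ∀ z z' w : Z, leftInner (z + z') w = leftInner z w + leftInner z' w
  leftInner_smul : ∀ (c : ℂ) (z w : Z), leftInner (c • z) w = c • leftInner z w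
  leftInner_left : ∀ (a : A) (z w : Z), leftInner (left.hom a z) w = a * leftInner z w
  star_leftInner : ∀ z w : Z, star (leftInner z w) = leftInner w z
  leftInner_self_nonneg : ∀ z : Z, 0 ≤ leftInner z z
  leftInner_smulRight : ∀ (b : B) (z w : Z),
    leftInner (smulRight (op b) z) w = leftInner z (smulRight (op (star b)) w)
  full_left : closure (Submodule.span ℂ {a : A | ∃ z w : Z, a = leftInner z w} : Set A) = Set.univ
  leftInner_imprimitivity : ∀ x y z : Z,
    left.hom (leftInner x y) z = smulRight (op (inner y z)) x

/-! ### Facts needed for the conjugate bimodule -/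

namespace RightHilbertModule

variable {B X : Type*} [CStarAlgebra B] [PartialOrder B] [StarOrderedRing B]
  [NormedAddCommGroup X] [NormedSpace ℂ X] (E : RightHilbertModule B X)

lemma inner_add_left (x y z : X) : E.inner (x + y) z = E.inner x z + E.inner y z := by
  rw [← E.star_inner z, map_add, star_add, E.star_inner, E.star_inner]

lemma inner_smulRight_left (x y : X) (b : B) :
    E.inner (E.smulRight (op b) x) y = star b * E.inner x y := by
  rw [← E.star_inner y, E.inner_smulRight, star_mul, E.star_inner]

lemma ext_inner {x y : X} (h : ∀ w, E.inner w x = E.inner w y) : x = y := by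
  have h0 : E.inner (x - y) (x - y) = 0 := by rw [map_sub, h, sub_self]
  have h1 := E.norm_sq_eq (x - y)
  rw [h0, norm_zero] at h1
  have h2 : ‖x - y‖ = 0 := by simpa using h1
  exact sub_eq_zero.mp (norm_eq_zero.mp h2)

end RightHilbertModule

namespace HilbertBimodule

variable {A B X : Type*} [CStarAlgebra A] [CStarAlgebra B] [PartialOrder B]
  [StarOrderedRing B] [NormedAddCommGroup X] [NormedSpace ℂ X] (E : HilbertBimodule A B X)

lemma left_smulRight (a : A) (b : B) (x : X) :
    E.left.hom a (E.smulRight (op b) x) = E.smulRight (op b) (E.left.hom a x) := by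
  apply E.ext_inner
  intro w
  have h : ∀ y, E.inner w (E.left.hom a y) = E.inner (E.left.hom (star a) w) y := by
    intro y; rw [E.left.adjoint, star_star]
  rw [h, E.inner_smulRight, E.inner_smulRight, h]

end HilbertBimodule

/-- `‖a‖² - a* a` is of the form `c* c`. -/
lemma exists_star_mul_self_compl {A : Type*} [CStarAlgebra A] [PartialOrder A]
    [StarOrderedRing A] (a : A) :
    ∃ c : A, star c * c = algebraMap ℂ A ((‖a‖ ^ 2 : ℝ) : ℂ) - star a * a := by
  have h : star a * a ≤ algebraMap ℝ A (‖a‖ ^ 2) := by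
    have h1 := IsSelfAdjoint.le_algebraMap_norm_self (IsSelfAdjoint.star_mul_self a)
    rwa [CStarRing.norm_star_mul_self, ← pow_two] at h1
  obtain ⟨c, hc⟩ := CStarAlgebra.nonneg_iff_eq_star_mul_self.mp (sub_nonneg.mpr h)
  refine ⟨c, ?_⟩
  rw [← hc]
  congr 1

lemma norm_self_mul_mul {C : Type*} [CStarAlgebra C] (p : C) (hp : star p = p) :
    ‖p * (p * p)‖ = ‖p‖ ^ 3 := by
  have hsq : ‖p * p‖ = ‖p‖ * ‖p‖ := by
    have := CStarRing.norm_star_mul_self (x := p)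
    rwa [hp] at this
  have h4 : ‖(p * p) * (p * p)‖ = ‖p * p‖ * ‖p * p‖ := by
    have := CStarRing.norm_star_mul_self (x := p * p)
    rwa [star_mul, hp] at this
  apply le_antisymm
  · calc ‖p * (p * p)‖ ≤ ‖p‖ * ‖p * p‖ := norm_mul_le _ _
      _ = ‖p‖ ^ 3 := by rw [hsq]; ring
  · rcases (norm_nonneg p).eq_or_lt with h0 | h0
    · rw [← h0]; simp
    · have h5 : ‖(p * p) * (p * p)‖ ≤ ‖p‖ * ‖p * (p * p)‖ := by
        rw [mul_assoc]; exact norm_mul_le _ _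
      rw [h4, hsq] at h5
      have h6 : ‖p‖ * ‖p‖ ^ 3 ≤ ‖p‖ * ‖p * (p * p)‖ := by linarith [h5, pow_succ ‖p‖ 3]
      exact le_of_mul_le_mul_left h6 h0

namespace ImprimitivityBimodule

variable {A B Z : Type*} [CStarAlgebra A] [PartialOrder A]
    [StarOrderedRing A] [CStarAlgebra B] [PartialOrder B] [StarOrderedRing B]
    [NormedAddCommGroup Z] [NormedSpace ℂ Z] (E : ImprimitivityBimodule A B Z)

lemma leftInner_add_right (z w w' : Z) :
    E.leftInner z (w + w') = E.leftInner z w + E.leftInner z w' := by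
  rw [← E.star_leftInner, E.leftInner_add, star_add, E.star_leftInner, E.star_leftInner]

lemma leftInner_smul_right (c : ℂ) (z w : Z) :
    E.leftInner z (c • w) = star c • E.leftInner z w := by
  rw [← E.star_leftInner, E.leftInner_smul, star_smul, E.star_leftInner]

lemma leftInner_sub_right (z w w' : Z) :
    E.leftInner z (w - w') = E.leftInner z w - E.leftInner z w' := by
  rw [eq_sub_iff_add_eq, ← E.leftInner_add_right, sub_add_cancel]

lemma leftInner_left_right (a : A) (z w : Z) :
    E.leftInner z (E.left.hom a w) = E.leftInner z w * star a := by
  rw [← E.star_leftInner, E.leftInner_left, star_mul, E.star_leftInner]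

lemma norm_inner_left_le (a : A) (z : Z) :
    ‖E.inner (E.left.hom a z) (E.left.hom a z)‖ ≤ ‖a‖ ^ 2 * ‖E.inner z z‖ := by
  obtain ⟨c, hc⟩ := exists_star_mul_self_compl a
  have key : ∀ d : A, E.inner (E.left.hom d z) (E.left.hom d z)
      = E.inner z (E.left.hom (star d * d) z) := by
    intro d
    rw [E.left.adjoint, map_mul]
    rfl
  have h1 := E.inner_self_nonneg (E.left.hom c z)
  rw [key, hc, map_sub, LinearMap.sub_apply, map_sub, ← key, AlgHom.commutes,
    Module.algebraMap_end_apply, map_smul, sub_nonneg] at h1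
  refine (CStarAlgebra.norm_le_norm_of_nonneg_of_le (E.inner_self_nonneg _) h1).trans ?_
  rw [norm_smul]
  simp

lemma norm_leftInner_right_le (b : B) (z : Z) :
    ‖E.leftInner (E.smulRight (op b) z) (E.smulRight (op b) z)‖
      ≤ ‖b‖ ^ 2 * ‖E.leftInner z z‖ := by
  obtain ⟨c, hc⟩ := exists_star_mul_self_compl (star b)
  have key : ∀ d : B, E.leftInner (E.smulRight (op (star d)) z) (E.smulRight (op (star d)) z)
      = E.leftInner z (E.smulRight (op (star d * d)) z) := by
    intro d
    rw [E.leftInner_smulRight, star_star, op_mul, map_mul]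
    rfl
  have h1 := E.leftInner_self_nonneg (E.smulRight (op (star c)) z)
  have h2 : op (algebraMap ℂ B ((‖star b‖ ^ 2 : ℝ) : ℂ) - star (star b) * star b)
      = algebraMap ℂ Bᵐᵒᵖ ((‖star b‖ ^ 2 : ℝ) : ℂ) - op (star (star b) * star b) := rfl
  rw [key, hc, h2, map_sub, LinearMap.sub_apply, E.leftInner_sub_right, ← key, AlgHom.commutes,
    Module.algebraMap_end_apply, E.leftInner_smul_right, sub_nonneg, star_star] at h1
  refine (CStarAlgebra.norm_le_norm_of_nonneg_of_le (E.leftInner_self_nonneg _) h1).trans ?_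
  rw [norm_smul]
  simp

/-- The norms given by the left and by the right inner product coincide. -/
theorem norm_leftInner_self (z : Z) : ‖E.leftInner z z‖ = ‖z‖ ^ 2 := by
  rw [E.norm_sq_eq]
  set p := E.leftInner z z with hp
  set q := E.inner z z with hq
  have hpz : E.left.hom p z = E.smulRight (op q) z := E.leftInner_imprimitivity z z z
  have h1 : ‖q‖ ^ 3 ≤ ‖p‖ ^ 2 * ‖q‖ := by
    have h := E.norm_inner_left_le p z
    rw [hpz, E.inner_smulRight, E.inner_smulRight_left, ← hq] at h
    have hs : star q = q := E.star_inner z z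
    rw [hs, mul_assoc, norm_self_mul_mul q hs] at h
    exact h
  have h2 : ‖p‖ ^ 3 ≤ ‖q‖ ^ 2 * ‖p‖ := by
    have h := E.norm_leftInner_right_le q z
    rw [← hpz, E.leftInner_left, E.leftInner_left_right, ← hp] at h
    have hs : star p = p := E.star_leftInner z z
    rw [hs, norm_self_mul_mul p hs] at h
    exact h
  have hp0 := norm_nonneg p
  have hq0 := norm_nonneg q
  rcases hp0.eq_or_lt with h | h
  · rw [← h] at h1 ⊢
    have : ‖q‖ ^ 3 = 0 := le_antisymm (by simpa using h1) (by positivity)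
    exact (pow_eq_zero_iff (by norm_num)).mp this |>.symm
  · rcases hq0.eq_or_lt with h' | h'
    · rw [← h'] at h2
      have : ‖p‖ ^ 3 > 0 := by positivity
      simp only [ne_eq, OfNat.ofNat_ne_zero, not_false_eq_true, zero_pow, zero_mul] at h2
      linarith
    · apply le_antisymm
      · have : ‖p‖ ^ 2 ≤ ‖q‖ ^ 2 := le_of_mul_le_mul_right (by linarith [pow_succ ‖p‖ 2]) h
        exact (pow_le_pow_iff_left₀ hp0 hq0 (by norm_num)).mp this
      · have : ‖q‖ ^ 2 ≤ ‖p‖ ^ 2 := le_of_mul_le_mul_right (by linarith [pow_succ ‖q‖ 2]) h'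
        exact (pow_le_pow_iff_left₀ hq0 hp0 (by norm_num)).mp this

lemma leftInner_eq_zero_of_left {a : A} (h : ∀ z, E.left.hom a z = 0) : a = 0 := by
  have hz : ∀ w : Z, E.leftInner 0 w = 0 := by
    intro w
    have := E.leftInner_smul 0 0 w
    simpa using this
  have hcl : ∀ c ∈ closure (Submodule.span ℂ {a : A | ∃ z w : Z, a = E.leftInner z w} : Set A),
      a * c = 0 := by
    have hclosed : IsClosed {c : A | a * c = 0} :=
      isClosed_eq (by fun_prop) continuous_const
    apply closure_minimal _ hclosed
    intro c hc
    induction hc using Submodule.span_induction with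
    | mem c hc =>
      obtain ⟨z, w, rfl⟩ := hc
      change a * _ = 0
      rw [← E.leftInner_left, h, hz]
    | zero => simp
    | add x y _ _ hx hy =>
      change a * (x + y) = 0
      rw [mul_add, hx, hy, add_zero]
    | smul c x _ hx =>
      change a * (c • x) = 0
      rw [mul_smul_comm, hx, smul_zero]
  have := hcl 1 (by rw [E.full_left]; trivial)
  simpa using this

end ImprimitivityBimodule

/-- A compatible action on an imprimitivity bimodule also respects the left inner product. -/
lemma CompatibleAction.leftInner_eq {A B G Z : Type*} [CStarAlgebra A] [PartialOrder A]
    [StarOrderedRing A] [CStarAlgebra B] [PartialOrder B] [StarOrderedRing B] [Group G]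
    [NormedAddCommGroup Z] [NormedSpace ℂ Z] {S : TwistedSystem A G} {Θ : TwistedSystem B G}
    {E : ImprimitivityBimodule A B Z} (d : CompatibleAction S Θ E.toHilbertBimodule)
    (g : G) (z w : Z) :
    E.leftInner (d.δ g z) (d.δ g w) = S.act g (E.leftInner z w) := by
  rw [← sub_eq_zero]
  apply E.leftInner_eq_zero_of_left
  intro y
  obtain ⟨x, rfl⟩ := (d.δ g).surjective y
  rw [map_sub, LinearMap.sub_apply, ← d.map_left, E.leftInner_imprimitivity,
    E.leftInner_imprimitivity, d.inner_eq, d.map_right, sub_self]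

/-! ### The conjugate bimodule -/

/-- The conjugate `Z̃` of a complex normed space `Z`: the same normed group, with
`c • z̃ = (conj c • z)~`. -/
def ConjSpace (Z : Type*) : Type _ := Z

namespace ConjSpace

/-- The map `z ↦ z̃`. -/
def mk {Z : Type*} (z : Z) : ConjSpace Z := z

/-- The map `z̃ ↦ z`. -/
def out {Z : Type*} (z : ConjSpace Z) : Z := z

instance {Z : Type*} [NormedAddCommGroup Z] : NormedAddCommGroup (ConjSpace Z) :=
  inferInstanceAs (NormedAddCommGroup Z)

instance {Z : Type*} [NormedAddCommGroup Z] [NormedSpace ℂ Z] : Module ℂ (ConjSpace Z) where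
  smul c z := mk (star c • out z)
  one_smul z := by
    change star (1 : ℂ) • out z = out z
    simp
  mul_smul c d z := by
    change star (c * d) • out z = star c • star d • out z
    rw [star_mul', mul_smul]
  smul_zero c := smul_zero (A := Z) (star c)
  smul_add c z w := smul_add (A := Z) (star c) z w
  add_smul c d z := by
    change star (c + d) • out z = star c • out z + star d • out z
    rw [star_add, add_smul]
  zero_smul z := by
    change star (0 : ℂ) • out z = (0 : Z)
    simp

lemma smul_def {Z : Type*} [NormedAddCommGroup Z] [NormedSpace ℂ Z] (c : ℂ) (z : ConjSpace Z) :
    c • z = mk (star c • out z) := rfl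

instance {Z : Type*} [NormedAddCommGroup Z] [NormedSpace ℂ Z] : NormedSpace ℂ (ConjSpace Z) where
  norm_smul_le c z := by
    change ‖star c • out z‖ ≤ ‖c‖ * ‖out z‖
    rw [norm_smul, norm_star]

/-- The operator `z̃ ↦ (T z)~`. -/
def mapEnd {Z : Type*} [NormedAddCommGroup Z] [NormedSpace ℂ Z] (T : Module.End ℂ Z) :
    Module.End ℂ (ConjSpace Z) where
  toFun z := mk (T (out z))
  map_add' z w := T.map_add z w
  map_smul' c z := T.map_smul (star c) z

/-- The invertible bounded operator `z̃ ↦ (T z)~`. -/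
def mapEquiv {Z : Type*} [NormedAddCommGroup Z] [NormedSpace ℂ Z] (T : Z ≃L[ℂ] Z) :
    ConjSpace Z ≃L[ℂ] ConjSpace Z where
  toFun z := mk (T (out z))
  invFun z := mk (T.symm (out z))
  map_add' z w := T.map_add z w
  map_smul' c z := T.map_smul (star c) z
  left_inv z := T.symm_apply_apply z
  right_inv z := T.apply_symm_apply z
  continuous_toFun := T.continuous
  continuous_invFun := T.symm.continuous

end ConjSpace

open ConjSpace in
/-- The conjugate right Hilbert `B`-`A` bimodule `Z̃` of an `A`-`B` imprimitivity bimodule `Z`: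
`z̃ · a = (a* · z)~`, `b · z̃ = (z · b*)~`, `⟪z̃, w̃⟫_A = leftInner z w`. -/
def ImprimitivityBimodule.conj {A B Z : Type*} [CStarAlgebra A] [PartialOrder A]
    [StarOrderedRing A] [CStarAlgebra B] [PartialOrder B] [StarOrderedRing B]
    [NormedAddCommGroup Z] [NormedSpace ℂ Z] (E : ImprimitivityBimodule A B Z) :
    HilbertBimodule B A (ConjSpace Z) where
  smulRight :=
    { toFun := fun a => mapEnd (E.left.hom (star (unop a)))
      map_one' := by
        ext z
        change E.left.hom (star (1 : A)) (out z) = out z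
        simp
      map_mul' := fun a b => by
        ext z
        change E.left.hom (star (unop b * unop a)) (out z)
          = E.left.hom (star (unop a)) (E.left.hom (star (unop b)) (out z))
        rw [star_mul, map_mul]
        rfl
      map_zero' := by
        ext z
        change E.left.hom (star (0 : A)) (out z) = (0 : Z)
        simp
      map_add' := fun a b => by
        ext z
        change E.left.hom (star (unop a + unop b)) (out z)
          = E.left.hom (star (unop a)) (out z) + E.left.hom (star (unop b)) (out z)
        simp
      commutes' := fun c => by
        ext z
        change E.left.hom (star (algebraMap ℂ A c)) (out z) = star c • out z
        rw [← algebraMap_star_comm, AlgHom.commutes, Module.algebraMap_end_apply] }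
  inner := fun z =>
    { toFun := fun w => E.leftInner (out z) (out w)
      map_add' := fun w w' => E.leftInner_add_right _ _ _
      map_smul' := fun c w => by
        change E.leftInner (out z) (star c • out w) = c • E.leftInner (out z) (out w)
        rw [E.leftInner_smul_right, star_star] }
  inner_smulRight := fun z w a => by
    change E.leftInner (out z) (E.left.hom (star a) (out w)) = E.leftInner (out z) (out w) * a
    rw [E.leftInner_left_right, star_star]
  star_inner := fun z w => E.star_leftInner _ _
  inner_self_nonneg := fun z => E.leftInner_self_nonneg _
  norm_sq_eq := fun z => (E.norm_leftInner_self (out z)).symm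
  complete := E.complete
  left :=
    { hom :=
        { toFun := fun b => mapEnd (E.smulRight (op (star b)))
          map_one' := by
            ext z
            change E.smulRight (op (star (1 : B))) (out z) = out z
            simp
          map_mul' := fun a b => by
            ext z
            change E.smulRight (op (star (a * b))) (out z)
              = E.smulRight (op (star a)) (E.smulRight (op (star b)) (out z))
            rw [star_mul, op_mul, map_mul]
            rfl
          map_zero' := by
            ext z
            change E.smulRight (op (star (0 : B))) (out z) = (0 : Z)
            simp
          map_add' := fun a b => by
            ext z
            change E.smulRight (op (star (a + b))) (out z)
              = E.smulRight (op (star a)) (out z) + E.smulRight (op (star b)) (out z)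
            simp
          commutes' := fun c => by
            ext z
            change E.smulRight (op (star (algebraMap ℂ B c))) (out z) = star c • out z
            rw [← algebraMap_star_comm]
            change E.smulRight (algebraMap ℂ Bᵐᵒᵖ (star c)) (out z) = star c • out z
            rw [AlgHom.commutes, Module.algebraMap_end_apply] }
      adjoint := fun b z w => by
        change E.leftInner (E.smulRight (op (star b)) (out z)) (out w)
          = E.leftInner (out z) (E.smulRight (op (star (star b))) (out w))
        rw [E.leftInner_smulRight] }

open ConjSpace in
/-- The `(Θ, Σ)`-compatible action `δ̃(g) z̃ = (δ(g) z)~` on the conjugate bimodule. -/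
def CompatibleAction.conj {A B G Z : Type*} [CStarAlgebra A] [PartialOrder A]
    [StarOrderedRing A] [CStarAlgebra B] [PartialOrder B] [StarOrderedRing B] [Group G]
    [NormedAddCommGroup Z] [NormedSpace ℂ Z] {S : TwistedSystem A G} {Θ : TwistedSystem B G}
    {E : ImprimitivityBimodule A B Z} (d : CompatibleAction S Θ E.toHilbertBimodule) :
    CompatibleAction Θ S E.conj where
  δ := fun g => mapEquiv (d.δ g)
  map_left := fun g b z => by
    change d.δ g (E.smulRight (op (star b)) (out z))
      = E.smulRight (op (star (Θ.act g b))) (d.δ g (out z))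
    rw [d.map_right, map_star]
  map_right := fun g z a => by
    change d.δ g (E.left.hom (star a) (out z))
      = E.left.hom (star (S.act g a)) (d.δ g (out z))
    rw [d.map_left, map_star]
  mul_eq := fun g h z => by
    change d.δ g (d.δ h (out z))
      = E.left.hom (star (star (S.cocycle g h : A)))
          (E.smulRight (op (star (Θ.cocycle g h : B))) (d.δ (g * h) (out z)))
    rw [star_star, E.left_smulRight, d.mul_eq]
  inner_eq := fun g z w => d.leftInner_eq g (out z) (out w)

/-- The linear map `F_{z,z',ζ,ζ'}(T) = S_{δ,z',ζ'} · T · S_{δ̃,z̃,ζ̃}`. -/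
noncomputable def CompatibleAction.transfer {A B G Z : Type*} [CStarAlgebra A] [PartialOrder A]
    [StarOrderedRing A] [CStarAlgebra B] [PartialOrder B] [StarOrderedRing B] [Group G]
    [NormedAddCommGroup Z] [NormedSpace ℂ Z] {S : TwistedSystem A G} {Θ : TwistedSystem B G}
    {E : ImprimitivityBimodule A B Z} (d : CompatibleAction S Θ E.toHilbertBimodule)
    (z z' ζ ζ' : Z) : CoeffMap G A A →ₗ[ℂ] CoeffMap G B B where
  toFun T := ((d.coeff z' ζ').mul T).mul (d.conj.coeff (ConjSpace.mk z) (ConjSpace.mk ζ))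
  map_add' T T' := by
    ext g b
    simp [CoeffMap.mul]
  map_smul' c T := by
    ext g b
    simp [CoeffMap.mul]

/-- The linear map `T' ↦ S_{δ̃,z̃,ζ̃} · T' · S_{δ,z',ζ'}` in the opposite direction. -/
noncomputable def CompatibleAction.transferBack {A B G Z : Type*} [CStarAlgebra A] [PartialOrder A]
    [StarOrderedRing A] [CStarAlgebra B] [PartialOrder B] [StarOrderedRing B] [Group G]
    [NormedAddCommGroup Z] [NormedSpace ℂ Z] {S : TwistedSystem A G} {Θ : TwistedSystem B G}
    {E : ImprimitivityBimodule A B Z} (d : CompatibleAction S Θ E.toHilbertBimodule)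
    (z z' ζ ζ' : Z) : CoeffMap G B B →ₗ[ℂ] CoeffMap G A A where
  toFun T := ((d.conj.coeff (ConjSpace.mk z) (ConjSpace.mk ζ)).mul T).mul (d.coeff z' ζ')
  map_add' T T' := by
    ext g b
    simp [CoeffMap.mul]
  map_smul' c T := by
    ext g b
    simp [CoeffMap.mul]

/-! An equivariant representation of `Σ` is the same thing as a `(Σ, Σ)`-compatible action on an
`A`-`A` bimodule, so all the maps involved are coefficients of compatible actions. Two constructions
and one identity give the theorem.

Composition is interior tensor product: `⟪y, ⟪x, a · δ(g)x'⟫ · δ'(g)y'⟫` is the coefficient of the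
diagonal action at `x ⊗ y` and `x' ⊗ y'` (`coeff_mul_coeff`). If `T` is a coefficient on `X`, then
`S_δ · T · S_δ̃` is therefore a coefficient on `Z̃ ⊗ (X ⊗ Z)` and lies in `B(Θ)`. Direct sums make
`B(Θ)` a linear space (`coeff_add_coeff`), so it contains the span.

Conversely, imprimitivity gives `S_{δ,z',ζ'}(g, S_{δ̃,z̃,ζ̃}(g, b)) = ⟪z',z⟫ b β_g(⟪ζ,ζ'⟫)`
(`coeff_conj_coeff`). Fullness and unitality give a finite sum `∑ ⟪u_i,w_i⟫ = 1`, so finitely many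
products `S · S̃` add up to the identity. Inserting this identity on both sides of `T'` in `B(Θ)`
yields a sum of terms `S · (S̃ · T' · S) · S̃`, with the bracket in `B(Σ)` by the first half with
the roles exchanged (`eq_span`). The second equality is symmetric.

The analytic work lies in the tensor product. Its inner product is positive because Gram matrices
over a C*-algebra factor as `C* C`. Definiteness and completeness come from a separated completion,
to which all the structure extends by continuity. -/

/-! ### Pre-Hilbert modules and their completions -/

/-- A right pre-Hilbert `B`-module: a right Hilbert module without definiteness and completeness. -/
structure PreHilbertModule (B V : Type*) [CStarAlgebra B] [PartialOrder B] [StarOrderedRing B]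
    [AddCommGroup V] [Module ℂ V] where
  smulRight : Bᵐᵒᵖ →ₐ[ℂ] Module.End ℂ V
  inner : V → V →ₗ[ℂ] B
  inner_smulRight : ∀ (x y : V) (b : B), inner x (smulRight (op b) y) = inner x y * b
  star_inner : ∀ x y : V, star (inner x y) = inner y x
  inner_self_nonneg : ∀ x : V, 0 ≤ inner x x

namespace PreHilbertModule

section Basic

variable {B V : Type*} [CStarAlgebra B] [PartialOrder B] [StarOrderedRing B]
  [AddCommGroup V] [Module ℂ V] (P : PreHilbertModule B V)

lemma inner_add_left (x y z : V) : P.inner (x + y) z = P.inner x z + P.inner y z := by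
  rw [← P.star_inner z, map_add, star_add, P.star_inner, P.star_inner]

lemma inner_smul_left (c : ℂ) (x z : V) : P.inner (c • x) z = star c • P.inner x z := by
  rw [← P.star_inner z, map_smul, star_smul, P.star_inner]

lemma inner_sub_left (x y z : V) : P.inner (x - y) z = P.inner x z - P.inner y z := by
  rw [← P.star_inner z, map_sub, star_sub, P.star_inner, P.star_inner]

lemma inner_smulRight_left (x y : V) (b : B) :
    P.inner (P.smulRight (op b) x) y = star b * P.inner x y := by
  rw [← P.star_inner y, P.inner_smulRight, star_mul, P.star_inner]

lemma norm_inner_smul_smul (c : ℂ) (x : V) :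
    ‖P.inner (c • x) (c • x)‖ = ‖c‖ ^ 2 * ‖P.inner x x‖ := by
  rw [map_smul, P.inner_smul_left, norm_smul, norm_smul, norm_star]; ring

lemma inner_add_add (x y : V) : P.inner (x + y) (x + y)
    = (P.inner x x + P.inner y x) + (P.inner x y + P.inner y y) := by
  rw [map_add, P.inner_add_left, P.inner_add_left]

/-- With `a = ⟪x,y⟫`, expand `0 ≤ ⟪z,z⟫` for `z = t (x · a) - y` and use `a* ⟪x,x⟫ a ≤ ‖⟪x,x⟫‖ a*
a`. The parameter `t` stays free because `⟪x,x⟫` may vanish. -/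
lemma two_smul_star_inner_mul_inner_le (x y : V) (t : ℝ) :
    (2 * t) • (star (P.inner x y) * P.inner x y)
      ≤ (t ^ 2 * ‖P.inner x x‖) • (star (P.inner x y) * P.inner x y) + P.inner y y := by
  set a := P.inner x y with ha
  have h0 := P.inner_self_nonneg ((t : ℂ) • P.smulRight (op a) x - y)
  have hyx : P.inner y x = star a := (P.star_inner x y).symm
  rw [map_sub, P.inner_sub_left, P.inner_sub_left, map_smul, map_smul, P.inner_smul_left,
    P.inner_smul_left, P.inner_smulRight, P.inner_smulRight, P.inner_smulRight_left,
    P.inner_smulRight_left, hyx, ← ha] at h0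
  have h1 : star a * P.inner x x * a ≤ ‖P.inner x x‖ • (star a * a) := by
    have h := star_left_conjugate_le_conjugate
      (IsSelfAdjoint.le_algebraMap_norm_self (P.star_inner x x : IsSelfAdjoint _)) a
    rwa [← Algebra.commutes, mul_assoc (algebraMap ℝ B _), ← Algebra.smul_def] at h
  have h2 : t ^ 2 • (star a * P.inner x x * a) ≤ t ^ 2 • ‖P.inner x x‖ • (star a * a) :=
    smul_le_smul_of_nonneg_left h1 (sq_nonneg t)
  have h3 : (0 : B) ≤ t ^ 2 • (star a * P.inner x x * a) - (2 * t) • (star a * a)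
      + P.inner y y := by
    convert h0 using 1
    simp only [Complex.star_def, Complex.conj_ofReal, Complex.coe_smul]
    module
  rw [mul_smul (t ^ 2)]
  have h4 := sub_nonneg.mpr h2
  rw [← sub_nonneg]
  convert add_nonneg h3 h4 using 1
  abel

/-- The Cauchy–Schwarz inequality. -/
theorem norm_inner_sq_le (x y : V) :
    ‖P.inner x y‖ ^ 2 ≤ ‖P.inner x x‖ * ‖P.inner y y‖ := by
  -- A strict upper bound `N` of `‖⟪x,x⟫‖` is positive even when `x` has length zero, so `t = N⁻¹`
  -- is available. It yields `N⁻¹ a* a ≤ ⟪y,y⟫`.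
  have key : ∀ N : ℝ, ‖P.inner x x‖ < N → ‖P.inner x y‖ ^ 2 ≤ N * ‖P.inner y y‖ := by
    intro N hN
    have hN0 : 0 < N := (norm_nonneg _).trans_lt hN
    set a := P.inner x y
    have h := P.two_smul_star_inner_mul_inner_le x y N⁻¹
    have haa : 0 ≤ star a * a := star_mul_self_nonneg a
    have h1 : N⁻¹ • (star a * a) ≤ P.inner y y := by
      have h2 : (N⁻¹ ^ 2 * ‖P.inner x x‖) • (star a * a) ≤ N⁻¹ • (star a * a) := by
        apply smul_le_smul_of_nonneg_right _ haa
        calc N⁻¹ ^ 2 * ‖P.inner x x‖ ≤ N⁻¹ ^ 2 * N := by gcongr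
          _ = N⁻¹ := by field_simp
      have h3 := h.trans (add_le_add_left h2 _)
      rw [two_mul, add_smul] at h3
      exact le_of_add_le_add_left h3
    have h4 := CStarAlgebra.norm_le_norm_of_nonneg_of_le
      (smul_nonneg (inv_nonneg.mpr hN0.le) haa) h1
    rw [norm_smul, CStarRing.norm_star_mul_self, norm_inv, Real.norm_of_nonneg hN0.le,
      inv_mul_le_iff₀ hN0] at h4
    rwa [pow_two]
  -- Let `N` decrease to `‖⟪x,x⟫‖`; the `+ 1` in the denominator covers the case `⟪y,y⟫ = 0`.
  have hcl : ∀ ε > 0, ‖P.inner x y‖ ^ 2 ≤ ‖P.inner x x‖ * ‖P.inner y y‖ + ε := by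
    intro ε hε
    have h := key (‖P.inner x x‖ + ε / (‖P.inner y y‖ + 1))
      (lt_add_of_pos_right _ (by positivity))
    refine h.trans ?_
    rw [add_mul]
    gcongr
    rw [div_mul_eq_mul_div, div_le_iff₀ (by positivity)]
    nlinarith [norm_nonneg (P.inner y y)]
  exact le_of_forall_pos_le_add hcl

/-- A copy of `V` carrying the seminorm of `P`. -/
def Space (_P : PreHilbertModule B V) : Type _ := V

instance : AddCommGroup P.Space := inferInstanceAs (AddCommGroup V)

instance : Module ℂ P.Space := inferInstanceAs (Module ℂ V)

noncomputable instance : Norm P.Space := ⟨fun x => √‖P.inner x x‖⟩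

lemma norm_def (x : P.Space) : ‖x‖ = √‖P.inner x x‖ := rfl

lemma norm_sq_eq (x : P.Space) : ‖x‖ ^ 2 = ‖P.inner x x‖ := Real.sq_sqrt (norm_nonneg _)

lemma norm_inner_le (x y : P.Space) : ‖P.inner x y‖ ≤ ‖x‖ * ‖y‖ := by
  rw [norm_def, norm_def, ← Real.sqrt_mul (norm_nonneg _)]
  exact Real.le_sqrt_of_sq_le (P.norm_inner_sq_le x y)

lemma seminormedSpaceCore : SeminormedSpace.Core ℂ P.Space where
  norm_nonneg _ := Real.sqrt_nonneg _
  norm_smul c x := by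
    rw [norm_def, norm_def]
    refine (congrArg Real.sqrt (P.norm_inner_smul_smul c x)).trans ?_
    rw [Real.sqrt_mul (by positivity), Real.sqrt_sq (norm_nonneg _)]
  norm_triangle x y := by
    refine Real.sqrt_le_iff.mpr ⟨add_nonneg (Real.sqrt_nonneg _) (Real.sqrt_nonneg _), ?_⟩
    calc ‖P.inner (x + y : V) (x + y : V)‖
        ≤ (‖P.inner x x‖ + ‖P.inner y x‖) + (‖P.inner x y‖ + ‖P.inner y y‖) := by
          refine (congrArg norm (P.inner_add_add x y)).le.trans ?_
          exact (norm_add_le _ _).trans (add_le_add (norm_add_le _ _) (norm_add_le _ _))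
      _ ≤ (‖x‖ ^ 2 + ‖y‖ * ‖x‖) + (‖x‖ * ‖y‖ + ‖y‖ ^ 2) := by
          rw [P.norm_sq_eq, P.norm_sq_eq]
          exact add_le_add (add_le_add_right (P.norm_inner_le y x) _)
            (add_le_add_left (P.norm_inner_le x y) _)
      _ = (‖x‖ + ‖y‖) ^ 2 := by ring

noncomputable instance : SeminormedAddCommGroup P.Space :=
  SeminormedAddCommGroup.ofCore P.seminormedSpaceCore

instance : NormedSpace ℂ P.Space where
  norm_smul_le c x := (P.seminormedSpaceCore.norm_smul c x).le

/-- The completion of a pre-Hilbert module; vectors of length zero become zero. -/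
abbrev Completion : Type _ := UniformSpace.Completion P.Space

/-- The canonical map to the completion. -/
noncomputable def ι : V →ₗ[ℂ] P.Completion :=
  ((UniformSpace.Completion.toComplₗᵢ : P.Space →ₗᵢ[ℂ] P.Completion).toLinearMap :
    P.Space →ₗ[ℂ] P.Completion)

lemma denseRange_ι : DenseRange P.ι := UniformSpace.Completion.denseRange_coe (α := P.Space)

lemma norm_ι (x : V) : ‖P.ι x‖ = √‖P.inner x x‖ :=
  UniformSpace.Completion.norm_coe (E := P.Space) x

lemma norm_ι_sq (x : V) : ‖P.ι x‖ ^ 2 = ‖P.inner x x‖ := by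
  rw [norm_ι, Real.sq_sqrt (norm_nonneg _)]

lemma norm_inner_le_ι (x y : V) : ‖P.inner x y‖ ≤ ‖P.ι x‖ * ‖P.ι y‖ := by
  rw [norm_ι, norm_ι]
  exact P.norm_inner_le x y

/-- The inner product with a fixed left vector of the pre-Hilbert module. -/
noncomputable def innerLeft : V →ₗ⋆[ℂ] (P.Completion →L[ℂ] B) where
  toFun x := (P.inner x).extendOfNorm P.ι
  map_add' x y := by
    refine ContinuousLinearMap.coeFn_injective (P.denseRange_ι.equalizer (by fun_prop)
      (by fun_prop) ?_)
    funext z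
    simp only [Function.comp_apply, add_apply]
    rw [LinearMap.extendOfNorm_eq P.denseRange_ι ⟨_, P.norm_inner_le_ι (x + y)⟩,
      LinearMap.extendOfNorm_eq P.denseRange_ι ⟨_, P.norm_inner_le_ι x⟩,
      LinearMap.extendOfNorm_eq P.denseRange_ι ⟨_, P.norm_inner_le_ι y⟩, P.inner_add_left]
  map_smul' c x := by
    refine ContinuousLinearMap.coeFn_injective (P.denseRange_ι.equalizer (by fun_prop)
      (by fun_prop) ?_)
    funext z
    simp only [Function.comp_apply, smul_apply]
    rw [LinearMap.extendOfNorm_eq P.denseRange_ι ⟨_, P.norm_inner_le_ι (c • x)⟩,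
      LinearMap.extendOfNorm_eq P.denseRange_ι ⟨_, P.norm_inner_le_ι x⟩, P.inner_smul_left]
    rfl

lemma innerLeft_ι (x y : V) : P.innerLeft x (P.ι y) = P.inner x y :=
  LinearMap.extendOfNorm_eq P.denseRange_ι ⟨_, P.norm_inner_le_ι x⟩ y

lemma norm_innerLeft_le (x : V) : ‖P.innerLeft x‖ ≤ 1 * ‖P.ι x‖ := by
  rw [one_mul]
  exact LinearMap.opNorm_extendOfNorm_le P.denseRange_ι (norm_nonneg _) (P.norm_inner_le_ι x)

/-- The inner product of the completion. -/
noncomputable def complInner : P.Completion →L⋆[ℂ] (P.Completion →L[ℂ] B) :=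
  P.innerLeft.extendOfNorm P.ι

@[simp]
lemma complInner_ι (x y : V) : P.complInner (P.ι x) (P.ι y) = P.inner x y := by
  rw [complInner, LinearMap.extendOfNorm_eq P.denseRange_ι ⟨1, P.norm_innerLeft_le⟩, innerLeft_ι]

@[elab_as_elim]
lemma induction_ι {p : P.Completion → Prop} (hp : IsClosed {x | p x}) (h : ∀ v, p (P.ι v))
    (x : P.Completion) : p x :=
  P.denseRange_ι.induction_on x hp h

/-- The extension of a bounded operator to the completion. -/
noncomputable def extend (T : Module.End ℂ V) : P.Completion →L[ℂ] P.Completion :=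
  (P.ι ∘ₗ T).extendOfNorm P.ι

/-- Boundedness of an operator for the seminorm of `P`. -/
def Bounded (T : Module.End ℂ V) : Prop :=
  ∃ C : ℝ, ∀ v, ‖P.inner (T v) (T v)‖ ≤ C ^ 2 * ‖P.inner v v‖

variable {P} in
lemma Bounded.exists_norm_ι_le {T : Module.End ℂ V} (hT : P.Bounded T) :
    ∃ C, ∀ v, ‖P.ι (T v)‖ ≤ C * ‖P.ι v‖ := by
  obtain ⟨C, hC⟩ := hT
  refine ⟨|C|, fun v => ?_⟩
  rw [norm_ι, norm_ι, ← Real.sqrt_sq_eq_abs, ← Real.sqrt_mul (sq_nonneg _)]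
  exact Real.sqrt_le_sqrt (hC v)

variable {P} in
lemma Bounded.extend_ι {T : Module.End ℂ V} (hT : P.Bounded T) (v : V) :
    P.extend T (P.ι v) = P.ι (T v) :=
  LinearMap.extendOfNorm_eq P.denseRange_ι hT.exists_norm_ι_le v

/-- Write `‖a‖² - a* a = c* c`; then `‖a‖² ⟪z,z⟫ - ⟪az,az⟫ = ⟪cz,cz⟫ ≥ 0`. Thus a `*`-representation
of a C*-algebra is bounded even on an incomplete module. -/
lemma norm_inner_le_of_star_mul_self {A : Type*} [CStarAlgebra A] [PartialOrder A]
    [StarOrderedRing A] (f : A →ₐ[ℂ] Module.End ℂ V)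
    (hf : ∀ (a : A) (x y : V), P.inner (f a x) y = P.inner x (f (star a) y)) (a : A) (z : V) :
    ‖P.inner (f a z) (f a z)‖ ≤ ‖a‖ ^ 2 * ‖P.inner z z‖ := by
  obtain ⟨c, hc⟩ := exists_star_mul_self_compl a
  have key : ∀ d : A, P.inner (f d z) (f d z) = P.inner z (f (star d * d) z) := by
    intro d
    rw [hf, map_mul]
    rfl
  have h1 := P.inner_self_nonneg (f c z)
  rw [key, hc, map_sub, LinearMap.sub_apply, map_sub, ← key, AlgHom.commutes,
    Module.algebraMap_end_apply, map_smul, sub_nonneg] at h1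
  refine (CStarAlgebra.norm_le_norm_of_nonneg_of_le (P.inner_self_nonneg _) h1).trans ?_
  rw [norm_smul]
  simp

lemma bounded_of_adjoint {A : Type*} [CStarAlgebra A] [PartialOrder A] [StarOrderedRing A]
    (f : A →ₐ[ℂ] Module.End ℂ V)
    (hf : ∀ (a : A) (x y : V), P.inner (f a x) y = P.inner x (f (star a) y)) (a : A) :
    P.Bounded (f a) :=
  ⟨‖a‖, P.norm_inner_le_of_star_mul_self f hf a⟩

lemma bounded_smulRight (b : Bᵐᵒᵖ) : P.Bounded (P.smulRight b) := by
  refine ⟨‖b.unop‖, fun v => ?_⟩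
  rw [← op_unop b, P.inner_smulRight, P.inner_smulRight_left, unop_op]
  refine (norm_mul_le _ _).trans ?_
  refine (mul_le_mul_of_nonneg_right (norm_mul_le _ _) (norm_nonneg _)).trans ?_
  rw [norm_star]
  exact le_of_eq (by ring)

-- A continuous operator is determined by its values on the dense image of `ι`. Algebraic identities
-- between bounded operators thereby pass to their extensions.
variable {P} in
lemma Bounded.extend_unique {T : Module.End ℂ V} (hT : P.Bounded T)
    (T' : P.Completion →L[ℂ] P.Completion) (h : ∀ v, T' (P.ι v) = P.ι (T v)) :
    P.extend T = T' := by
  refine ContinuousLinearMap.coeFn_injective (P.denseRange_ι.equalizer (P.extend T).continuous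
    T'.continuous ?_)
  funext v
  exact (hT.extend_ι v).trans (h v).symm

/-- The extension of an algebra of bounded operators to the completion. -/
noncomputable def extendHom {R : Type*} [Semiring R] [Algebra ℂ R] (f : R →ₐ[ℂ] Module.End ℂ V)
    (hf : ∀ r, P.Bounded (f r)) : R →ₐ[ℂ] Module.End ℂ P.Completion :=
  AlgHom.ofLinearMap
    { toFun := fun r => (P.extend (f r)).toLinearMap
      map_add' := fun r s => by
        rw [(hf (r + s)).extend_unique (P.extend (f r) + P.extend (f s))]
        · rfl
        · intro v
          rw [add_apply, (hf r).extend_ι, (hf s).extend_ι, ← map_add, map_add f, LinearMap.add_apply]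
      map_smul' := fun c r => by
        rw [(hf (c • r)).extend_unique (c • P.extend (f r))]
        · rfl
        · intro v
          rw [smul_apply, (hf r).extend_ι, ← map_smul, map_smul f, LinearMap.smul_apply] }
    (by
      change (P.extend (f 1)).toLinearMap = 1
      rw [(hf 1).extend_unique (.id ℂ _)]
      · rfl
      · intro v
        rw [map_one, Module.End.one_apply, ContinuousLinearMap.id_apply])
    (fun r s => by
      change (P.extend (f (r * s))).toLinearMap
        = (P.extend (f r)).toLinearMap * (P.extend (f s)).toLinearMap
      rw [(hf (r * s)).extend_unique ((P.extend (f r)).comp (P.extend (f s)))]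
      · rfl
      · intro v
        rw [ContinuousLinearMap.comp_apply, (hf s).extend_ι, (hf r).extend_ι, map_mul,
          Module.End.mul_apply])

@[simp]
lemma extendHom_ι {R : Type*} [Semiring R] [Algebra ℂ R] (f : R →ₐ[ℂ] Module.End ℂ V)
    (hf : ∀ r, P.Bounded (f r)) (r : R) (v : V) :
    P.extendHom f hf r (P.ι v) = P.ι (f r v) := (hf r).extend_ι v

@[fun_prop]
lemma continuous_extendHom {R : Type*} [Semiring R] [Algebra ℂ R] (f : R →ₐ[ℂ] Module.End ℂ V)
    (hf : ∀ r, P.Bounded (f r)) (r : R) : Continuous (P.extendHom f hf r) :=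
  (P.extend (f r)).continuous

/-- The completion of a pre-Hilbert module as a Hilbert module. -/
noncomputable def toHilbert : RightHilbertModule B P.Completion where
  smulRight := P.extendHom P.smulRight P.bounded_smulRight
  inner x := (P.complInner x).toLinearMap
  inner_smulRight x y b := by
    change P.complInner x _ = P.complInner x y * b
    -- Both sides are continuous in each variable, so vectors from the dense image of `ι` suffice.
    induction x using P.induction_ι with
    | hp => exact isClosed_eq (by fun_prop) (by fun_prop)
    | h v =>
      induction y using P.induction_ι with
      | hp => exact isClosed_eq (by fun_prop) (by fun_prop)
      | h w =>
        rw [extendHom_ι, complInner_ι, complInner_ι, P.inner_smulRight]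
  star_inner x y := by
    change star (P.complInner x y) = P.complInner y x
    induction x using P.induction_ι with
    | hp => exact isClosed_eq (by fun_prop) (by fun_prop)
    | h v =>
      induction y using P.induction_ι with
      | hp => exact isClosed_eq (by fun_prop) (by fun_prop)
      | h w =>
        rw [complInner_ι, complInner_ι, P.star_inner]
  inner_self_nonneg x := by
    change 0 ≤ P.complInner x x
    induction x using P.induction_ι with
    | hp => exact CStarAlgebra.isClosed_nonneg.preimage (f := fun x => P.complInner x x) (by fun_prop)
    | h v =>
      rw [complInner_ι]
      exact P.inner_self_nonneg v
  norm_sq_eq x := by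
    change ‖x‖ ^ 2 = ‖P.complInner x x‖
    induction x using P.induction_ι with
    | hp => exact isClosed_eq (by fun_prop) (by fun_prop)
    | h v =>
      rw [complInner_ι, norm_ι_sq]
  complete := inferInstance

lemma toHilbert_inner (x y : P.Completion) : P.toHilbert.inner x y = P.complInner x y := rfl

end Basic

end PreHilbertModule

/-- A compatible action on a right pre-Hilbert `A`-`B` bimodule; the cocycle identity is only
required up to vectors of length zero. -/
structure PreCompatibleAction {A B G V : Type*} [CStarAlgebra A] [CStarAlgebra B] [PartialOrder B]
    [StarOrderedRing B] [Group G] [AddCommGroup V] [Module ℂ V]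
    (S : TwistedSystem A G) (Θ : TwistedSystem B G) (P : PreHilbertModule B V) where
  left : A →ₐ[ℂ] Module.End ℂ V
  adjoint : ∀ (a : A) (x y : V), P.inner (left a x) y = P.inner x (left (star a) y)
  δ : G → (V ≃ₗ[ℂ] V)
  map_left : ∀ (g : G) (a : A) (z : V), δ g (left a z) = left (S.act g a) (δ g z)
  map_right : ∀ (g : G) (z : V) (b : B),
    δ g (P.smulRight (op b) z) = P.smulRight (op (Θ.act g b)) (δ g z)
  mul_eq : ∀ (g h : G) (w z : V), P.inner w (δ g (δ h z))
    = P.inner w (P.smulRight (op (star (Θ.cocycle g h : B)))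
        (left (S.cocycle g h : A) (δ (g * h) z)))
  inner_eq : ∀ (g : G) (z w : V), P.inner (δ g z) (δ g w) = Θ.act g (P.inner z w)

/-! ### Completion of compatible actions. -/

namespace PreCompatibleAction

variable {A B G V : Type*} [CStarAlgebra A]
  [CStarAlgebra B] [PartialOrder B] [StarOrderedRing B] [Group G] [AddCommGroup V] [Module ℂ V]
  {S : TwistedSystem A G} {Θ : TwistedSystem B G} {P : PreHilbertModule B V}
  (d : PreCompatibleAction S Θ P)

/-- Automorphisms of a C*-algebra are isometric, so applying `Θ.act g` to `⟪v,v⟫` does not change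
its norm. -/
lemma norm_ι_δ (g : G) (v : V) : ‖P.ι (d.δ g v)‖ = ‖P.ι v‖ := by
  rw [P.norm_ι, P.norm_ι, d.inner_eq]
  congr 1
  exact NonUnitalStarAlgHom.norm_map (Θ.act g) (Θ.act g).injective _

/-- The extension of the action to the completion. -/
noncomputable def extendδ (g : G) : P.Completion ≃L[ℂ] P.Completion :=
  (d.δ g).extend P.ι P.ι P.denseRange_ι ⟨1, fun v => by rw [one_mul, d.norm_ι_δ]⟩
    P.denseRange_ι ⟨1, fun v => by rw [one_mul, ← d.norm_ι_δ g, LinearEquiv.apply_symm_apply]⟩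

@[simp]
lemma extendδ_ι (g : G) (v : V) : d.extendδ g (P.ι v) = P.ι (d.δ g v) :=
  LinearEquiv.extend_eq _ _ _ _ _ _ _ _

variable [PartialOrder A] [StarOrderedRing A]

/-- The Hilbert bimodule obtained by completion. -/
noncomputable def toBimodule : HilbertBimodule A B P.Completion where
  toRightHilbertModule := P.toHilbert
  left :=
    { hom := P.extendHom d.left (P.bounded_of_adjoint d.left d.adjoint)
      adjoint := fun a x y => by
        rw [P.toHilbert_inner, P.toHilbert_inner]
        induction x using P.induction_ι with
        | hp => exact isClosed_eq (by fun_prop) (by fun_prop)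
        | h v =>
          induction y using P.induction_ι with
          | hp => exact isClosed_eq (by fun_prop) (by fun_prop)
          | h w => simp only [P.extendHom_ι, P.complInner_ι, d.adjoint] }

lemma toBimodule_left_ι (a : A) (v : V) :
    d.toBimodule.left.hom a (P.ι v) = P.ι (d.left a v) :=
  P.extendHom_ι d.left (P.bounded_of_adjoint d.left d.adjoint) a v

lemma toBimodule_smulRight_ι (b : Bᵐᵒᵖ) (v : V) :
    d.toBimodule.smulRight b (P.ι v) = P.ι (P.smulRight b v) :=
  P.extendHom_ι P.smulRight P.bounded_smulRight b v

@[fun_prop]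
lemma continuous_toBimodule_left (a : A) : Continuous (d.toBimodule.left.hom a) :=
  P.continuous_extendHom d.left (P.bounded_of_adjoint d.left d.adjoint) a

@[fun_prop]
lemma continuous_toBimodule_smulRight (b : Bᵐᵒᵖ) : Continuous (d.toBimodule.smulRight b) :=
  P.continuous_extendHom P.smulRight P.bounded_smulRight b

lemma toBimodule_inner (x y : P.Completion) : d.toBimodule.inner x y = P.complInner x y := rfl

/-- The compatible action obtained by completion. -/
noncomputable def toAction : CompatibleAction S Θ d.toBimodule where
  δ := d.extendδ
  map_left g a z := by
    induction z using P.induction_ι with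
    | hp => exact isClosed_eq (by fun_prop) (by fun_prop)
    | h v => rw [toBimodule_left_ι, extendδ_ι, extendδ_ι, toBimodule_left_ι, d.map_left]
  map_right g z b := by
    induction z using P.induction_ι with
    | hp => exact isClosed_eq (by fun_prop) (by fun_prop)
    | h v => rw [toBimodule_smulRight_ι, extendδ_ι, extendδ_ι, toBimodule_smulRight_ι, d.map_right]
  mul_eq g h z := by
    induction z using P.induction_ι with
    | hp => exact isClosed_eq (by fun_prop) (by fun_prop)
    | h v =>
      rw [extendδ_ι, extendδ_ι, extendδ_ι, toBimodule_left_ι, toBimodule_smulRight_ι]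
      -- The cocycle identity is only known inside inner products; definiteness of the completed
      -- inner product turns it into an equality of vectors.
      apply d.toBimodule.ext_inner
      intro w
      rw [toBimodule_inner, toBimodule_inner]
      induction w using P.induction_ι with
      | hp => exact isClosed_eq (by fun_prop) (by fun_prop)
      | h w => rw [P.complInner_ι, P.complInner_ι, d.mul_eq]
  inner_eq g z w := by
    have hg : Continuous (Θ.act g) := (StarAlgEquiv.isometry (Θ.act g)).continuous
    rw [toBimodule_inner, toBimodule_inner]
    induction z using P.induction_ι with
    | hp => exact isClosed_eq (by fun_prop) (by fun_prop)
    | h v =>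
      induction w using P.induction_ι with
      | hp => exact isClosed_eq (by fun_prop) (by fun_prop)
      | h w => rw [extendδ_ι, extendδ_ι, P.complInner_ι, P.complInner_ι, d.inner_eq]

lemma toAction_coeff_ι (x y : V) (g : G) (a : A) :
    d.toAction.coeff (P.ι x) (P.ι y) g a = P.inner x (d.left a (d.δ g y)) := by
  change d.toBimodule.inner (P.ι x) (d.toBimodule.left.hom a (d.extendδ g (P.ι y))) = _
  rw [extendδ_ι, toBimodule_left_ι, toBimodule_inner, P.complInner_ι]

end PreCompatibleAction

/-! ### Equivariant representations as compatible actions. -/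

namespace EquivariantRep

variable {A G X : Type*} [CStarAlgebra A] [PartialOrder A] [StarOrderedRing A]
  [Group G] [NormedAddCommGroup X] [NormedSpace ℂ X] {S : TwistedSystem A G}

/-- The Hilbert bimodule of an equivariant representation. -/
def toBimodule {E : RightHilbertModule A X} (R : EquivariantRep S E) : HilbertBimodule A A X where
  toRightHilbertModule := E
  left := R.ρ

/-- An equivariant representation as a compatible action. -/
def toAction {E : RightHilbertModule A X} (R : EquivariantRep S E) :
    CompatibleAction S S R.toBimodule where
  δ := R.v
  map_left g a z := by
    change R.v g (R.ρ.hom a z) = R.ρ.hom (S.act g a) (R.v g z)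
    rw [R.conj_eq, ContinuousLinearEquiv.symm_apply_apply]
  map_right := R.smul_eq
  mul_eq := R.mul_eq
  inner_eq g z w := (R.inner_eq g z w).symm

/-- A compatible action of a system with itself as an equivariant representation. -/
def ofAction {E : HilbertBimodule A A X} (d : CompatibleAction S S E) :
    EquivariantRep S E.toRightHilbertModule where
  ρ := E.left
  v := d.δ
  conj_eq g a x := by rw [d.map_left, ContinuousLinearEquiv.apply_symm_apply]
  mul_eq := d.mul_eq
  inner_eq g x y := (d.inner_eq g x y).symm
  smul_eq := d.map_right

end EquivariantRep

/-- The covariance relation says `v(g) ρ(a) = ρ(α_g(a)) v(g)`, which is left compatibility. Tensor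
products and direct sums then need to be built only for compatible actions. -/
lemma mem_fourierStieltjes_iff {A G : Type u} [CStarAlgebra A] [PartialOrder A]
    [StarOrderedRing A] [Group G] {S : TwistedSystem A G} {T : CoeffMap G A A} :
    T ∈ FourierStieltjes S ↔ ∃ (X : Type u) (_ : NormedAddCommGroup X) (_ : NormedSpace ℂ X)
      (E : HilbertBimodule A A X) (d : CompatibleAction S S E) (x y : X), T = d.coeff x y := by
  constructor
  · rintro ⟨X, i, j, E, R, x, y, rfl⟩
    exact ⟨X, i, j, R.toBimodule, R.toAction, x, y, rfl⟩
  · rintro ⟨X, i, j, E, d, x, y, rfl⟩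
    exact ⟨X, i, j, E.toRightHilbertModule, .ofAction d, x, y, rfl⟩

/-! ### Positivity of Gram matrices -/

/-- The `i`-th diagonal entry is `∑ k, C_ki* C_ki`, a sum of positive elements. If it is also
nonpositive, every summand vanishes. -/
lemma CStarMatrix.eq_zero_of_star_mul_self_diag_nonpos {n B : Type*} [Fintype n] [CStarAlgebra B]
    [PartialOrder B] [StarOrderedRing B] (C : CStarMatrix n n B)
    (h : ∀ i, (star C * C) i i ≤ 0) : C = 0 := by
  ext k i
  have hi : (star C * C) i i = ∑ k, star (C k i) * C k i := by
    rw [CStarMatrix.mul_apply]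
    rfl
  have h0 : ∑ k, star (C k i) * C k i = 0 :=
    le_antisymm (hi ▸ h i) (Finset.sum_nonneg fun k _ => star_mul_self_nonneg _)
  have h1 := (Finset.sum_eq_zero_iff_of_nonneg fun k _ => star_mul_self_nonneg (C k i)).mp h0 k
    (Finset.mem_univ k)
  exact CStarRing.star_mul_self_eq_zero_iff _ |>.mp h1

/-- Take `N = M⁻`: then `M = M⁺ - M⁻` and `M⁺ M⁻ = 0` give `M N = -N²`. The conclusion involves only
products and adjoints, so it can be compared with entrywise positivity of a matrix. -/
lemma IsSelfAdjoint.exists_star_mul_self_negPart {A : Type*} [CStarAlgebra A] [PartialOrder A]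
    [StarOrderedRing A] {M : A} (hM : IsSelfAdjoint M) :
    ∃ N D : A, N = star D * D ∧ M * N = -(N * N) ∧ (N = 0 → ∃ C, M = star C * C) := by
  have hM' : M⁺ = M + M⁻ := by
    rw [← sub_eq_iff_eq_add]
    exact CFC.posPart_sub_negPart M hM
  obtain ⟨D, hD⟩ := CStarAlgebra.nonneg_iff_eq_star_mul_self.mp (CFC.negPart_nonneg M)
  refine ⟨M⁻, D, hD, ?_, fun h => ?_⟩
  · rw [eq_neg_iff_add_eq_zero, ← add_mul, ← hM', CFC.posPart_mul_negPart]
  · rw [h, add_zero] at hM'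
    exact CStarAlgebra.nonneg_iff_eq_star_mul_self.mp (hM' ▸ CFC.posPart_nonneg M)

/-- A selfadjoint matrix over a C*-algebra which is positive as a quadratic form factors as
`star C * C`. -/
theorem CStarMatrix.exists_eq_star_mul_self {n B : Type*} [Fintype n] [DecidableEq n]
    [CStarAlgebra B] [PartialOrder B] [StarOrderedRing B] (M : CStarMatrix n n B)
    (hM : IsSelfAdjoint M)
    (h : ∀ c : n → B, 0 ≤ ∑ i, ∑ j, star (c i) * M i j * c j) :
    ∃ C : CStarMatrix n n B, M = star C * C := by
  obtain ⟨N, D, hD, hMN, hN⟩ := hM.exists_star_mul_self_negPart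
  have hNs : star N = N := by rw [hD, star_mul, star_star]
  -- Compressing by the negative part gives `N M N = -N³`, and `N = D* D` turns `N³` into `(DN)*
  -- (DN)`.
  have h3 : star N * M * N = -(star (D * N) * (D * N)) := by
    rw [mul_assoc, hMN, star_mul, hNs, mul_neg, mul_assoc N (star D), ← mul_assoc (star D), ← hD]
  have hDN : D * N = 0 := by
    apply eq_zero_of_star_mul_self_diag_nonpos
    intro i
    have h4 : (star (D * N) * (D * N)) i i = -(star N * M * N) i i := by
      rw [h3, CStarMatrix.neg_apply, neg_neg]
    rw [h4, neg_nonpos]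
    -- This diagonal entry is the quadratic form of `M` at the `i`-th column of `N`, hence
    -- nonnegative.
    have h5 : (star N * M * N) i i = ∑ k, ∑ l, star (N k i) * M k l * N l i := by
      rw [CStarMatrix.mul_apply, Finset.sum_comm]
      refine Finset.sum_congr rfl fun l _ => ?_
      rw [CStarMatrix.mul_apply, Finset.sum_mul]
      rfl
    rw [h5]
    exact h fun k => N k i
  have hNN : star N * N = 0 := by
    rw [hNs]
    nth_rewrite 1 [hD]
    rw [mul_assoc, hDN, mul_zero]
  exact hN (CStarRing.star_mul_self_eq_zero_iff _ |>.mp hNN)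

namespace RightHilbertModule

variable {B X : Type*} [CStarAlgebra B] [PartialOrder B] [StarOrderedRing B]
  [NormedAddCommGroup X] [NormedSpace ℂ X] (E : RightHilbertModule B X)

lemma inner_smul_left (c : ℂ) (x z : X) : E.inner (c • x) z = star c • E.inner x z := by
  rw [← E.star_inner z, map_smul, star_smul, E.star_inner]

/-- The inner product as a conjugate-linear map. -/
noncomputable def innerₛₗ : X →ₗ⋆[ℂ] X →ₗ[ℂ] B where
  toFun := E.inner
  map_add' x y := LinearMap.ext fun z => E.inner_add_left x y z
  map_smul' c x := LinearMap.ext fun z => E.inner_smul_left c x z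

lemma inner_sum_left {n : Type*} (s : Finset n) (f : n → X) (z : X) :
    E.inner (∑ i ∈ s, f i) z = ∑ i ∈ s, E.inner (f i) z := by
  change E.innerₛₗ _ z = _
  rw [map_sum, LinearMap.sum_apply]
  rfl

/-- The Gram matrix of a finite family in a Hilbert module is of the form `star C * C`. -/
lemma exists_gram_eq {n : Type*} [Fintype n] (x : n → X) :
    ∃ C : n → n → B, ∀ i j, E.inner (x i) (x j) = ∑ k, star (C k i) * C k j := by
  classical
  obtain ⟨C, hC⟩ := CStarMatrix.exists_eq_star_mul_self
    (CStarMatrix.ofMatrix (Matrix.of fun i j => E.inner (x i) (x j)))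
    (by
      ext i j
      exact E.star_inner (x j) (x i))
    (by
      intro c
      -- The quadratic form of the Gram matrix at `c` is the inner square of `∑ x_i · c_i`.
      have h := E.inner_self_nonneg (∑ i, E.smulRight (op (c i)) (x i))
      rw [E.inner_sum_left] at h
      convert h using 2 with i
      rw [map_sum]
      refine Finset.sum_congr rfl fun j _ => ?_
      rw [E.inner_smulRight, E.inner_smulRight_left]
      rfl)
  refine ⟨C, fun i j => ?_⟩
  have h := congrArg (fun M : CStarMatrix n n B => M i j) hC
  exact h.trans CStarMatrix.mul_apply

end RightHilbertModule

/-! ### Interior tensor products -/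

namespace HilbertBimodule

open TensorProduct

variable {B C X Y : Type*} [CStarAlgebra B] [PartialOrder B] [StarOrderedRing B]
  [CStarAlgebra C] [PartialOrder C] [StarOrderedRing C]
  [NormedAddCommGroup X] [NormedSpace ℂ X] [NormedAddCommGroup Y] [NormedSpace ℂ Y]
  (E : RightHilbertModule B X) (F : HilbertBimodule B C Y)

/-- The linear map `x' ⊗ y' ↦ ⟪y, ⟪x, x'⟫ y'⟫`. -/
noncomputable def tensorInnerAux (x : X) (y : Y) : X ⊗[ℂ] Y →ₗ[ℂ] C :=
  F.inner y ∘ₗ TensorProduct.lift (F.left.hom.toLinearMap ∘ₗ E.inner x)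

lemma tensorInnerAux_tmul (x x' : X) (y y' : Y) :
    tensorInnerAux E F x y (x' ⊗ₜ y') = F.inner y (F.left.hom (E.inner x x') y') := rfl

/-- The inner product of the algebraic interior tensor product. -/
noncomputable def tensorInner : X ⊗[ℂ] Y →ₗ⋆[ℂ] (X ⊗[ℂ] Y →ₗ[ℂ] C) :=
  TensorProduct.lift (LinearMap.mk₂'ₛₗ (starRingEnd ℂ) (starRingEnd ℂ) (tensorInnerAux E F)
    (fun x₁ x₂ y => by
      ext x' y'
      simp [tensorInnerAux_tmul, E.inner_add_left])
    (fun c x y => by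
      ext x' y'
      simp [tensorInnerAux_tmul, E.inner_smul_left])
    (fun x y₁ y₂ => by
      ext x' y'
      simp [tensorInnerAux_tmul, F.inner_add_left])
    (fun c x y => by
      ext x' y'
      simp [tensorInnerAux_tmul, F.inner_smul_left]))

@[simp]
lemma tensorInner_tmul (x x' : X) (y y' : Y) :
    tensorInner E F (x ⊗ₜ y) (x' ⊗ₜ y') = F.inner y (F.left.hom (E.inner x x') y') := rfl

/-- For `t = ∑ x_i ⊗ y_i`, factor the Gram matrix as `⟪x_i,x_j⟫ = ∑ k, D_ki* D_kj`. Moving `D_ki*`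
across the inner product of `Y` turns `⟪t,t⟫` into `∑ k, ⟪∑ i, D_ki y_i, ∑ j, D_kj y_j⟫`. -/
lemma tensorInner_self_nonneg (t : X ⊗[ℂ] Y) : 0 ≤ tensorInner E F t t := by
  obtain ⟨s, rfl⟩ := TensorProduct.exists_finset t
  obtain ⟨D, hD⟩ := E.exists_gram_eq fun i : s => i.1.1
  rw [← Finset.sum_coe_sort s]
  have h : tensorInner E F (∑ i : s, i.1.1 ⊗ₜ[ℂ] i.1.2) (∑ i : s, i.1.1 ⊗ₜ[ℂ] i.1.2)
      = ∑ k : s, F.inner (∑ i : s, F.left.hom (D k i) i.1.2) (∑ j : s, F.left.hom (D k j) j.1.2) := by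
    simp only [map_sum, LinearMap.sum_apply, tensorInner_tmul, hD, map_mul, F.inner_sum_left,
      F.left.adjoint, Module.End.mul_apply]
    rw [Finset.sum_comm_cycle]
    exact Finset.sum_congr rfl fun k _ => Finset.sum_comm
  rw [h]
  exact Finset.sum_nonneg fun k _ => F.inner_self_nonneg _

lemma ext_tensorInner {P : X ⊗[ℂ] Y → X ⊗[ℂ] Y → Prop}
    (hz : ∀ t, P 0 t) (hz' : ∀ t, P t 0)
    (ha : ∀ s s' t, P s t → P s' t → P (s + s') t) (ha' : ∀ t s s', P t s → P t s' → P t (s + s'))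
    (h : ∀ x y x' y', P (x ⊗ₜ y) (x' ⊗ₜ y')) (s t : X ⊗[ℂ] Y) : P s t := by
  induction s with
  | zero => exact hz t
  | add s s' hs hs' => exact ha _ _ _ hs hs'
  | tmul x y =>
    induction t with
    | zero => exact hz' _
    | add s s' hs hs' => exact ha' _ _ _ hs hs'
    | tmul x' y' => exact h _ _ _ _

/-- The algebraic interior tensor product as a pre-Hilbert module. -/
noncomputable def tensor : PreHilbertModule C (X ⊗[ℂ] Y) where
  smulRight := (Module.End.lTensorAlgHom ℂ Y X).comp F.smulRight
  inner := tensorInner E F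
  inner_smulRight s t b := by
    induction s, t using ext_tensorInner with
    | hz t => simp
    | hz' t => simp
    | ha s s' t hs hs' => simp only [map_add, LinearMap.add_apply, hs, hs', add_mul]
    | ha' t s s' hs hs' => simp only [map_add, hs, hs', add_mul]
    | h x y x' y' =>
      change tensorInner E F (x ⊗ₜ y) (x' ⊗ₜ F.smulRight (op b) y') = _
      rw [tensorInner_tmul, tensorInner_tmul, F.left_smulRight, F.inner_smulRight]
  star_inner s t := by
    induction s, t using ext_tensorInner with
    | hz t => simp
    | hz' t => simp
    | ha s s' t hs hs' => simp [hs, hs']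
    | ha' t s s' hs hs' => simp [hs, hs']
    | h x y x' y' =>
      rw [tensorInner_tmul, tensorInner_tmul, F.star_inner, F.left.adjoint, E.star_inner]
  inner_self_nonneg := tensorInner_self_nonneg E F

end HilbertBimodule

namespace CompatibleAction

open TensorProduct HilbertBimodule

variable {A B C G X Y : Type*} [CStarAlgebra A] [CStarAlgebra B] [PartialOrder B]
  [StarOrderedRing B] [CStarAlgebra C] [PartialOrder C] [StarOrderedRing C] [Group G]
  [NormedAddCommGroup X] [NormedSpace ℂ X] [NormedAddCommGroup Y] [NormedSpace ℂ Y]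
  {S : TwistedSystem A G} {Θ : TwistedSystem B G} {Ω : TwistedSystem C G}
  {E : HilbertBimodule A B X} {F : HilbertBimodule B C Y}

/-- The diagonal action on the algebraic interior tensor product. -/
noncomputable def tensor (d : CompatibleAction S Θ E) (d' : CompatibleAction Θ Ω F) :
    PreCompatibleAction S Ω (HilbertBimodule.tensor E.toRightHilbertModule F) where
  left := (Module.End.rTensorAlgHom ℂ X Y).comp E.left.hom
  adjoint a s t := by
    change tensorInner _ _ _ _ = tensorInner _ _ _ _
    induction s, t using ext_tensorInner with
    | hz t => simp
    | hz' t => simp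
    | ha s s' t hs hs' => simp only [map_add, LinearMap.add_apply, hs, hs']
    | ha' t s s' hs hs' => simp only [map_add, hs, hs']
    | h x y x' y' =>
      change tensorInner _ _ (E.left.hom a x ⊗ₜ y) (x' ⊗ₜ y')
        = tensorInner _ _ (x ⊗ₜ y) (E.left.hom (star a) x' ⊗ₜ y')
      rw [tensorInner_tmul, tensorInner_tmul, E.left.adjoint]
  δ g := TensorProduct.congr (d.δ g).toLinearEquiv (d'.δ g).toLinearEquiv
  map_left g a t := by
    induction t with
    | zero => simp
    | add s s' hs hs' => simp only [map_add, hs, hs']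
    | tmul x y =>
      change d.δ g (E.left.hom a x) ⊗ₜ d'.δ g y = E.left.hom (S.act g a) (d.δ g x) ⊗ₜ d'.δ g y
      rw [d.map_left]
  map_right g t b := by
    induction t with
    | zero => simp
    | add s s' hs hs' => simp only [map_add, hs, hs']
    | tmul x y =>
      change d.δ g x ⊗ₜ d'.δ g (F.smulRight (op b) y)
        = d.δ g x ⊗ₜ F.smulRight (op (Ω.act g b)) (d'.δ g y)
      rw [d'.map_right]
  mul_eq g h s t := by
    change tensorInner _ _ _ _ = tensorInner _ _ _ _
    induction s, t using ext_tensorInner with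
    | hz t => simp
    | hz' t => simp
    | ha s s' t hs hs' => simp only [map_add, LinearMap.add_apply, hs, hs']
    | ha' t s s' hs hs' => simp only [map_add, hs, hs']
    | h x y x' y' =>
      change tensorInner _ _ (x ⊗ₜ y) (d.δ g (d.δ h x') ⊗ₜ d'.δ g (d'.δ h y'))
        = tensorInner _ _ (x ⊗ₜ y) (E.left.hom (S.cocycle g h : A) (d.δ (g * h) x') ⊗ₜ
          F.smulRight (op (star (Ω.cocycle g h : C))) (d'.δ (g * h) y'))
      -- The first action contributes `θ(g,h)*` on the right of `X`, the second `θ(g,h)` on the left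
      -- of `Y`. The tensor product is over `ℂ` and not balanced over `B`, so they meet and cancel
      -- only inside the inner product.
      have hu : star (Θ.cocycle g h : B) * (Θ.cocycle g h : B) = 1 :=
        Unitary.coe_star_mul_self _
      rw [d.mul_eq, d'.mul_eq, tensorInner_tmul, tensorInner_tmul, E.inner_smulRight, map_mul,
        Module.End.mul_apply, F.left_smulRight, ← Module.End.mul_apply (F.left.hom (star _)),
        ← map_mul, hu, map_one, Module.End.one_apply]
  inner_eq g s t := by
    change tensorInner _ _ _ _ = Ω.act g (tensorInner _ _ _ _)
    induction s, t using ext_tensorInner with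
    | hz t => simp
    | hz' t => simp
    | ha s s' t hs hs' => simp only [map_add, LinearMap.add_apply, hs, hs']
    | ha' t s s' hs hs' => simp only [map_add, hs, hs']
    | h x y x' y' =>
      change tensorInner _ _ (d.δ g x ⊗ₜ d'.δ g y) (d.δ g x' ⊗ₜ d'.δ g y') = _
      rw [tensorInner_tmul, tensorInner_tmul, d.inner_eq, ← d'.map_left, d'.inner_eq]

/-- The product of coefficients is a coefficient of the interior tensor product. -/
lemma coeff_mul_coeff {A : Type*} [CStarAlgebra A] [PartialOrder A] [StarOrderedRing A]
    {S : TwistedSystem A G} {E : HilbertBimodule A B X}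
    (d : CompatibleAction S Θ E) (d' : CompatibleAction Θ Ω F) (x x' : X) (y y' : Y) :
    (d'.coeff y y').mul (d.coeff x x') =
      (d.tensor d').toAction.coeff ((HilbertBimodule.tensor E.toRightHilbertModule F).ι (x ⊗ₜ y))
        ((HilbertBimodule.tensor E.toRightHilbertModule F).ι (x' ⊗ₜ y')) := by
  funext g
  ext a
  rw [PreCompatibleAction.toAction_coeff_ι]
  rfl

end CompatibleAction

/-! ### Direct sums and the linear structure of the Fourier–Stieltjes algebra -/

namespace CompatibleAction

variable {A B G X Y : Type*} [CStarAlgebra A] [CStarAlgebra B] [PartialOrder B]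
  [StarOrderedRing B] [Group G] [NormedAddCommGroup X] [NormedSpace ℂ X]
  [NormedAddCommGroup Y] [NormedSpace ℂ Y] {S : TwistedSystem A G} {Θ : TwistedSystem B G}

/-- The algebraic direct sum of two Hilbert modules. -/
noncomputable def prodModule (E : RightHilbertModule B X) (F : RightHilbertModule B Y) :
    PreHilbertModule B (X × Y) where
  smulRight := (LinearMap.prodMapAlgHom ℂ X Y).comp (E.smulRight.prod F.smulRight)
  inner p := (E.inner p.1).coprod (F.inner p.2)
  inner_smulRight p q b := by
    change E.inner p.1 (E.smulRight (op b) q.1) + F.inner p.2 (F.smulRight (op b) q.2)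
      = (E.inner p.1 q.1 + F.inner p.2 q.2) * b
    rw [E.inner_smulRight, F.inner_smulRight, add_mul]
  star_inner p q := by
    change star (E.inner p.1 q.1 + F.inner p.2 q.2) = E.inner q.1 p.1 + F.inner q.2 p.2
    rw [star_add, E.star_inner, F.star_inner]
  inner_self_nonneg p := add_nonneg (E.inner_self_nonneg _) (F.inner_self_nonneg _)

/-- The direct sum of two compatible actions. -/
noncomputable def prod {E : HilbertBimodule A B X} {F : HilbertBimodule A B Y} (d : CompatibleAction S Θ E)
    (d' : CompatibleAction S Θ F) :
    PreCompatibleAction S Θ (prodModule E.toRightHilbertModule F.toRightHilbertModule) where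
  left := (LinearMap.prodMapAlgHom ℂ X Y).comp (E.left.hom.prod F.left.hom)
  adjoint a p q := congrArg₂ (· + ·) (E.left.adjoint a p.1 q.1) (F.left.adjoint a p.2 q.2)
  δ g := (d.δ g).toLinearEquiv.prodCongr (d'.δ g).toLinearEquiv
  map_left g a p := Prod.ext (d.map_left g a p.1) (d'.map_left g a p.2)
  map_right g p b := Prod.ext (d.map_right g p.1 b) (d'.map_right g p.2 b)
  mul_eq g h w p := congrArg _ (Prod.ext (d.mul_eq g h p.1) (d'.mul_eq g h p.2))
  inner_eq g p q := by
    change E.inner (d.δ g p.1) (d.δ g q.1) + F.inner (d'.δ g p.2) (d'.δ g q.2)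
      = Θ.act g (E.inner p.1 q.1 + F.inner p.2 q.2)
    rw [d.inner_eq, d'.inner_eq, map_add]

/-- A sum of coefficients is a coefficient of the direct sum. -/
lemma coeff_add_coeff {A : Type*} [CStarAlgebra A] [PartialOrder A] [StarOrderedRing A]
    {S : TwistedSystem A G} {E : HilbertBimodule A B X} {F : HilbertBimodule A B Y}
    (d : CompatibleAction S Θ E) (d' : CompatibleAction S Θ F) (x x' : X) (y y' : Y) :
    d.coeff x x' + d'.coeff y y' =
      (d.prod d').toAction.coeff
        ((prodModule E.toRightHilbertModule F.toRightHilbertModule).ι (x, y))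
        ((prodModule E.toRightHilbertModule F.toRightHilbertModule).ι (x', y')) := by
  funext g
  ext a
  rw [PreCompatibleAction.toAction_coeff_ι]
  rfl

lemma coeff_smul_right {E : HilbertBimodule A B X} (d : CompatibleAction S Θ E) (c : ℂ)
    (x y : X) : d.coeff x (c • y) = c • d.coeff x y := by
  funext g
  ext a
  change E.inner x (E.left.hom a (d.δ g (c • y))) = c • E.inner x (E.left.hom a (d.δ g y))
  rw [map_smul, map_smul, map_smul]

end CompatibleAction

namespace FourierStieltjes

variable {A B G : Type u} [CStarAlgebra A] [PartialOrder A] [StarOrderedRing A]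
  [CStarAlgebra B] [PartialOrder B] [StarOrderedRing B] [Group G]
  {S : TwistedSystem A G} {Θ : TwistedSystem B G}

lemma coeff_mem {X : Type u} [NormedAddCommGroup X] [NormedSpace ℂ X] {E : HilbertBimodule A A X}
    (d : CompatibleAction S S E) (x y : X) : d.coeff x y ∈ FourierStieltjes S :=
  mem_fourierStieltjes_iff.mpr ⟨X, _, _, E, d, x, y, rfl⟩

lemma add_mem {T T' : CoeffMap G A A} (h : T ∈ FourierStieltjes S)
    (h' : T' ∈ FourierStieltjes S) : T + T' ∈ FourierStieltjes S := by
  obtain ⟨X, _, _, E, d, x, x', rfl⟩ := mem_fourierStieltjes_iff.mp h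
  obtain ⟨Y, _, _, F, d', y, y', rfl⟩ := mem_fourierStieltjes_iff.mp h'
  rw [d.coeff_add_coeff]
  exact coeff_mem _ _ _

lemma smul_mem (c : ℂ) {T : CoeffMap G A A} (h : T ∈ FourierStieltjes S) :
    c • T ∈ FourierStieltjes S := by
  obtain ⟨X, _, _, E, d, x, x', rfl⟩ := mem_fourierStieltjes_iff.mp h
  rw [← d.coeff_smul_right]
  exact coeff_mem _ _ _

/-- The zero Hilbert module. -/
noncomputable def zeroModule (A : Type*) [CStarAlgebra A] [PartialOrder A] [StarOrderedRing A] :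
    PreHilbertModule A PUnit.{u + 1} where
  smulRight := AlgHom.ofLinearMap 0 (Subsingleton.elim _ _) fun _ _ => Subsingleton.elim _ _
  inner _ := 0
  inner_smulRight _ _ _ := by simp
  star_inner _ _ := by simp
  inner_self_nonneg _ := le_rfl

/-- The action on the zero Hilbert module. -/
noncomputable def zeroAction (S : TwistedSystem A G) : PreCompatibleAction S S (zeroModule.{u} A) where
  left := AlgHom.ofLinearMap 0 (Subsingleton.elim _ _) fun _ _ => Subsingleton.elim _ _
  adjoint _ _ _ := rfl
  δ _ := LinearEquiv.refl ℂ _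
  map_left _ _ _ := rfl
  map_right _ _ _ := rfl
  mul_eq _ _ _ _ := rfl
  inner_eq g _ _ := (map_zero (S.act g)).symm

/-- Closure under scalars gives zero once some coefficient exists; the zero module supplies one. -/
lemma zero_mem : (0 : CoeffMap G A A) ∈ FourierStieltjes S := by
  have h := smul_mem 0 (coeff_mem (zeroAction S).toAction 0 0)
  rwa [zero_smul] at h

variable (S) in
/-- The Fourier–Stieltjes algebra as a linear subspace. -/
def submodule : Submodule ℂ (CoeffMap G A A) where
  carrier := FourierStieltjes S
  add_mem' := add_mem
  zero_mem' := zero_mem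
  smul_mem' c _ := smul_mem c

variable {Z W : Type u} [NormedAddCommGroup Z] [NormedSpace ℂ Z] [NormedAddCommGroup W]
  [NormedSpace ℂ W] {E : HilbertBimodule A B Z} {F : HilbertBimodule B A W}

/-- Multiplying a coefficient of `S` by coefficients of compatible actions gives a coefficient
of `Θ`. -/
theorem coeff_mul_mul_coeff_mem (d : CompatibleAction S Θ E) (c : CompatibleAction Θ S F)
    {T : CoeffMap G A A} (hT : T ∈ FourierStieltjes S) (z ζ : Z) (w ω : W) :
    ((d.coeff z ζ).mul T).mul (c.coeff w ω) ∈ FourierStieltjes Θ := by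
  obtain ⟨X, _, _, H, r, x, y, rfl⟩ := mem_fourierStieltjes_iff.mp hT
  -- The product is realised on `W ⊗ (X ⊗ Z)`.
  rw [r.coeff_mul_coeff d, c.coeff_mul_coeff]
  exact coeff_mem _ _ _

/-- If products of coefficients of two opposite compatible actions sum up to the identity, the
Fourier–Stieltjes algebra of `Θ` is spanned by the products through that of `S`. -/
theorem eq_span (d : CompatibleAction S Θ E) (c : CompatibleAction Θ S F) {ι : Type*} [Fintype ι]
    (z ζ : ι → Z) (w ω : ι → W)
    (h : ∀ g b, ∑ i, d.coeff (z i) (ζ i) g (c.coeff (w i) (ω i) g b) = b) :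
    FourierStieltjes Θ = (Submodule.span ℂ {F : CoeffMap G B B | ∃ T ∈ FourierStieltjes S,
      ∃ (z ζ : Z) (w ω : W), F = ((d.coeff z ζ).mul T).mul (c.coeff w ω)} :
        Set (CoeffMap G B B)) := by
  apply subset_antisymm
  · intro T hT
    -- Insert the identity `∑ S_i · S̃_i` before and after `T` and regroup as `S_i · (S̃_i · T ·
    -- S_j) · S̃_j`. The bracket is a coefficient of `S` by `coeff_mul_mul_coeff_mem` with the two
    -- systems exchanged.
    have hsum : T = ∑ i, ∑ j, ((d.coeff (z i) (ζ i)).mul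
        (((c.coeff (w i) (ω i)).mul T).mul (d.coeff (z j) (ζ j)))).mul
          (c.coeff (w j) (ω j)) := by
      funext g
      ext b
      nth_rewrite 1 [← h g b]
      rw [← h g (T g _), map_sum]
      simp only [map_sum, Finset.sum_apply, LinearMap.sum_apply]
      rfl
    rw [hsum]
    exact Submodule.sum_mem _ fun i _ => Submodule.sum_mem _ fun j _ => Submodule.subset_span
      ⟨_, coeff_mul_mul_coeff_mem c d hT _ _ _ _, _, _, _, _, rfl⟩
  · refine Submodule.span_le (p := submodule Θ) |>.mpr ?_
    rintro _ ⟨T, hT, z, ζ, w, ω, rfl⟩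
    exact coeff_mul_mul_coeff_mem d c hT z ζ w ω

end FourierStieltjes

/-! ### Fullness and the identities for an imprimitivity bimodule -/

/-- A dense right ideal of a unital Banach algebra contains the unit. -/
lemma Submodule.one_mem_of_closure_eq_univ {R : Type*} [NormedRing R] [NormedAlgebra ℂ R]
    [CompleteSpace R] (N : Submodule ℂ R) (hN : ∀ s ∈ N, ∀ b, s * b ∈ N)
    (hcl : closure (N : Set R) = Set.univ) : (1 : R) ∈ N := by
  have h1 : (1 : R) ∈ closure (N : Set R) := hcl ▸ Set.mem_univ _
  -- An element at distance less than `1` from the unit is invertible, and a right ideal containing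
  -- it contains `s * s⁻¹ = 1`.
  obtain ⟨s, hs, hd⟩ := Metric.mem_closure_iff.mp h1 1 one_pos
  rw [dist_eq_norm] at hd
  have hu : s * (↑(Units.oneSub (1 - s) hd)⁻¹ : R) = 1 := by
    have h2 := Units.mul_inv (Units.oneSub (1 - s) hd)
    rwa [Units.val_oneSub, sub_sub_cancel] at h2
  rw [← hu]
  exact hN s hs _

/-- By `hmul` the span of the values of `f` is a right ideal; being dense, it contains the unit
exactly. The scalars of the linear combination are absorbed by `hsmul`. A bare function `f` covers
both the right and the left inner product. -/
lemma exists_sum_eq_one_of_closure_span {R Z : Type*} [NormedRing R] [NormedAlgebra ℂ R]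
    [CompleteSpace R] (f : Z → Z → R) (hsmul : ∀ (c : ℂ) (z w : Z), ∃ w', c • f z w = f z w')
    (hmul : ∀ (z w : Z) (b : R), ∃ w', f z w * b = f z w')
    (hcl : closure (Submodule.span ℂ {b : R | ∃ z w : Z, b = f z w} : Set R) = Set.univ) :
    ∃ (n : ℕ) (z w : Fin n → Z), ∑ i, f (z i) (w i) = 1 := by
  have h1 : (1 : R) ∈ Submodule.span ℂ {b : R | ∃ z w : Z, b = f z w} := by
    refine Submodule.one_mem_of_closure_eq_univ _ (fun s hs b => ?_) hcl
    induction hs using Submodule.span_induction with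
    | mem s hs =>
      obtain ⟨z, w, rfl⟩ := hs
      obtain ⟨w', h⟩ := hmul z w b
      exact Submodule.subset_span ⟨z, w', h⟩
    | zero => simp
    | add x y _ _ hx hy => rw [add_mul]; exact add_mem hx hy
    | smul c x _ hx => rw [smul_mul_assoc]; exact Submodule.smul_mem _ _ hx
  obtain ⟨n, c, b, h⟩ := Submodule.mem_span_set'.mp h1
  choose z w hzw using fun i => (b i).2
  choose w' hw' using fun i => hsmul (c i) (z i) (w i)
  refine ⟨n, z, w', ?_⟩
  rw [← h]
  exact Finset.sum_congr rfl fun i _ => by rw [← hw', ← hzw]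

namespace ImprimitivityBimodule

variable {A B Z : Type*} [CStarAlgebra A] [PartialOrder A] [StarOrderedRing A]
  [CStarAlgebra B] [PartialOrder B] [StarOrderedRing B]
  [NormedAddCommGroup Z] [NormedSpace ℂ Z] (E : ImprimitivityBimodule A B Z)

lemma exists_sum_inner_eq_one : ∃ (n : ℕ) (z w : Fin n → Z), ∑ i, E.inner (z i) (w i) = 1 :=
  exists_sum_eq_one_of_closure_span (fun z w => E.inner z w)
    (fun c _ w => ⟨c • w, (map_smul _ _ _).symm⟩)
    (fun z w b => ⟨E.smulRight (op b) w, (E.inner_smulRight z w b).symm⟩) E.full_right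

lemma exists_sum_leftInner_eq_one :
    ∃ (n : ℕ) (z w : Fin n → Z), ∑ i, E.leftInner (z i) (w i) = 1 :=
  exists_sum_eq_one_of_closure_span E.leftInner
    (fun c z w => ⟨star c • w, by rw [E.leftInner_smul_right, star_star]⟩)
    (fun z w a => ⟨E.left.hom (star a) w, by rw [E.leftInner_left_right, star_star]⟩) E.full_left

end ImprimitivityBimodule

namespace CompatibleAction

variable {A B G Z : Type*} [CStarAlgebra A] [PartialOrder A]
  [StarOrderedRing A] [CStarAlgebra B] [PartialOrder B] [StarOrderedRing B] [Group G]
  [NormedAddCommGroup Z] [NormedSpace ℂ Z] {S : TwistedSystem A G} {Θ : TwistedSystem B G}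
  {E : ImprimitivityBimodule A B Z} (d : CompatibleAction S Θ E.toHilbertBimodule)

/-- Imprimitivity replaces the left action of an `A`-valued inner product by right multiplication
with a `B`-valued one, which leaves `b` between two independent factors. A double sum over such
products therefore factorises. -/
lemma coeff_conj_coeff (z z' ζ ζ' : Z) (g : G) (b : B) :
    d.coeff z' ζ' g (d.conj.coeff (ConjSpace.mk z) (ConjSpace.mk ζ) g b)
      = E.inner z' z * b * Θ.act g (E.inner ζ ζ') := by
  change E.inner z' (E.left.hom (E.leftInner z (E.smulRight (op (star b)) (d.δ g ζ))) (d.δ g ζ'))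
    = _
  rw [E.leftInner_imprimitivity, E.inner_smulRight, E.inner_smulRight_left, star_star,
    d.inner_eq, mul_assoc]

/-- The mirror image: imprimitivity is read from right to left, and invariance of the left inner
product under `δ` produces the factor `α_g`. -/
lemma conj_coeff_coeff (z z' ζ ζ' : Z) (g : G) (a : A) :
    d.conj.coeff (ConjSpace.mk z) (ConjSpace.mk ζ) g (d.coeff z' ζ' g a)
      = E.leftInner z z' * a * S.act g (E.leftInner ζ' ζ) := by
  change E.leftInner z (E.smulRight (op (star (E.inner z' (E.left.hom a (d.δ g ζ'))))) (d.δ g ζ))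
    = _
  rw [E.star_inner, ← E.leftInner_imprimitivity, E.leftInner_left_right, E.star_leftInner,
    E.leftInner_left, d.leftInner_eq, mul_assoc]

end CompatibleAction

/-! ### The two span descriptions. -/

theorem mainTheorem3 {A B G Z : Type u}
    [CStarAlgebra A] [PartialOrder A] [StarOrderedRing A]
    [CStarAlgebra B] [PartialOrder B] [StarOrderedRing B]
    [Group G] [NormedAddCommGroup Z] [NormedSpace ℂ Z]
    (S : TwistedSystem A G) (Θ : TwistedSystem B G)
    (E : ImprimitivityBimodule A B Z) (d : CompatibleAction S Θ E.toHilbertBimodule) :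
    FourierStieltjes Θ =
      (Submodule.span ℂ {F : CoeffMap G B B | ∃ T ∈ FourierStieltjes S, ∃ z z' ζ ζ' : Z,
        F = d.transfer z z' ζ ζ' T} : Set (CoeffMap G B B)) ∧
    FourierStieltjes S =
      (Submodule.span ℂ {F : CoeffMap G A A | ∃ T ∈ FourierStieltjes Θ, ∃ z z' ζ ζ' : Z,
        F = d.transferBack z z' ζ ζ' T} : Set (CoeffMap G A A)) := by
  refine ⟨?_, ?_⟩
  · obtain ⟨n, u, w, h⟩ := E.exists_sum_inner_eq_one
    -- For the pair `(i, j)` the product is `⟪u_i,w_i⟫ b β_g(⟪u_j,w_j⟫)`: the first index sums to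
    -- `1` on the left of `b`, the second inside `β_g`.
    rw [FourierStieltjes.eq_span d d.conj (fun i : Fin n × Fin n => u i.1) (fun i => w i.2)
      (fun i => ConjSpace.mk (w i.1)) (fun i => ConjSpace.mk (u i.2))]
    · congr 2
      ext F
      constructor
      · rintro ⟨T, hT, z', ζ', z, ζ, rfl⟩
        exact ⟨T, hT, z, z', ζ, ζ', rfl⟩
      · rintro ⟨T, hT, z, z', ζ, ζ', rfl⟩
        exact ⟨T, hT, z', ζ', z, ζ, rfl⟩
    · intro g b
      simp only [d.coeff_conj_coeff, Fintype.sum_prod_type, ← Finset.mul_sum, ← Finset.sum_mul,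
        ← map_sum, h, map_one, one_mul, mul_one]
  · obtain ⟨n, u, w, h⟩ := E.exists_sum_leftInner_eq_one
    -- Here the pair `(i, j)` gives the product of `leftInner u_i w_i`, `a` and `α_g (leftInner u_j
    -- w_j)`.
    rw [FourierStieltjes.eq_span d.conj d (fun i : Fin n × Fin n => ConjSpace.mk (u i.1))
      (fun i => ConjSpace.mk (w i.2)) (fun i => w i.1) (fun i => u i.2)]
    · congr 2
      ext F
      constructor
      · rintro ⟨T, hT, z, ζ, z', ζ', rfl⟩
        exact ⟨T, hT, z, z', ζ, ζ', rfl⟩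
      · rintro ⟨T, hT, z, z', ζ, ζ', rfl⟩
        exact ⟨T, hT, z, ζ, z', ζ', rfl⟩
    · intro g a
      simp only [d.conj_coeff_coeff, Fintype.sum_prod_type, ← Finset.mul_sum, ← Finset.sum_mul,
        ← map_sum, h, map_one, one_mul, mul_one]
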